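/- **Prographs.** A PC prograph of size $n$ is a connected oriented planar graph without directed cycles, made of $n$ coproducts (one input, an ordered pair of left and right outputs) and $n$ products (an ordered pair of left and right inputs, one output); every output of an operator is connected to an input of an operator, except that one input (of a coproduct) and one output (of a product) remain unconnected and are the global input and the global output, both lying on the exterior face. It is drawn from bottom to top, and is considered up to renaming its operators. The only prograph of size $0$ is a single wire from the global input to the global output. The operators of a prograph of size $n$ receive the labels $1,2,\dots,2n$ from bottom to top and from left to right: the next label always goes to the leftmost operator all of whose inputs come from already labelled operators (or from the global input). **Trees.** For a (planar) binary tree $T$ let $dg(T)$, its number of disabled grafting sites, be the number of leaves to the left of its last node, where nodes are listed by depth-left-first search (root, left subtree, right subtree), and $dg(T)=0$ if $T$ has no node. Let $C(n,k)$ be the coefficient of $q^k$ in $Cat_n(q)=\sum_{\mathrm{size}(T)=n}q^{dg(T)}$, the sum being over the binary trees with $n$ nodes. For $n\ge 1$ they form a row of the Catalan triangle, namely $$C(n,k)=\binom{n-1+k}{k}-\binom{n-1+k}{k-1}\qquad(0\le k<n).$$ **Proposition.** For every $n\ge 0$, the PC prographs of size $n$ in which the coproducts receive the labels $1,\dots,n$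 and the products receive the labels $n+1,\dots,2n$ are counted by the pairs $(T_1,T_2)$ of binary trees of size $n$ with $dg(T_1)+dg(T_2)\le n$. Equivalently, their number is $$\sum_{d_1+d_2\le n}C(n,d_1)\,C(n,d_2)=\binom{3n}{n}-2\binom{3n}{n-1}+\binom{3n}{n-2}.$$ Here a binomial coefficient with a negative lower index is $0$. (The numbers are $1,1,4,21,121,728,4488,\dots$, OEIS A274969.) -/

import Mathlib

/-! ## Product-coproduct prographs -/

namespace PCPrograph

/-- The operators of a PC prograph of size `n`: `n` coproducts and `n` products. -/
inductive Op (n : ℕ) : Type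
  | cop (c : Fin n)
  | prod (p : Fin n)
  deriving DecidableEq

/-- The places where a wire starts: the global input, the left and right outputs of the
coproducts, the outputs of the products. -/
inductive OutPort (n : ℕ) : Type
  | source
  | copLeft (c : Fin n)
  | copRight (c : Fin n)
  | prodOut (p : Fin n)
  deriving DecidableEq

/-- The places where a wire ends: the global output, the inputs of the coproducts, the left and
right inputs of the products. -/
inductive InPort (n : ℕ) : Type
  | sink
  | copIn (c : Fin n)
  | prodLeft (p : Fin n)
  | prodRight (p : Fin n)
  deriving DecidableEq

/-- The operator that a port belongs to (none for the global input). -/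
def OutPort.owner {n : ℕ} : OutPort n → Option (Op n)
  | .source => none
  | .copLeft c => some (.cop c)
  | .copRight c => some (.cop c)
  | .prodOut p => some (.prod p)

/-- The operator that a port belongs to (none for the global output). -/
def InPort.owner {n : ℕ} : InPort n → Option (Op n)
  | .sink => none
  | .copIn c => some (.cop c)
  | .prodLeft p => some (.prod p)
  | .prodRight p => some (.prod p)

/-- The inputs of an operator, from left to right. -/
def Op.inputs {n : ℕ} : Op n → List (InPort n)
  | .cop c => [.copIn c]
  | .prod p => [.prodLeft p, .prodRight p]

/-- The outputs of an operator, from left to right. -/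
def Op.outputs {n : ℕ} : Op n → List (OutPort n)
  | .cop c => [.copLeft c, .copRight c]
  | .prod p => [.prodOut p]

/-! ### Planarity

A way to plug every output into an input is drawn on the sphere by a rotation system. The global
input and the global output are the two half-edges at one additional vertex of degree two: this
is the edge that joins the output to the input on the exterior side of the sphere. -/

/-- Half-edges of the closed-up graph. -/
abbrev HalfEdge (n : ℕ) : Type := OutPort n ⊕ InPort n

/-- The next half-edge counterclockwise around the same vertex. Wires run from bottom to top, so
around a coproduct one meets its input (below), its right output, its left output, and around a
product its output (above), its left input, its right input. -/
def next {n : ℕ} : HalfEdge n → HalfEdge n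
  | .inr (.copIn c) => .inl (.copRight c)
  | .inl (.copRight c) => .inl (.copLeft c)
  | .inl (.copLeft c) => .inr (.copIn c)
  | .inl (.prodOut p) => .inr (.prodLeft p)
  | .inr (.prodLeft p) => .inr (.prodRight p)
  | .inr (.prodRight p) => .inl (.prodOut p)
  | .inl .source => .inr .sink
  | .inr .sink => .inl .source

/-- `next` as a permutation of the half-edges; every cycle has length at most three. -/
def rotation (n : ℕ) : Equiv.Perm (HalfEdge n) where
  toFun := next
  invFun h := match h with
    | .inl .source => .inr .sink
    | .inr .sink => .inl .source
    | h => next (next h)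
  left_inv := by rintro (_ | _) <;> rename_i x <;> cases x <;> rfl
  right_inv := by rintro (_ | _) <;> rename_i x <;> cases x <;> rfl

/-- The involution that exchanges the two halves of every wire. -/
def opposite {n : ℕ} (w : OutPort n ≃ InPort n) : Equiv.Perm (HalfEdge n) :=
  (Equiv.sumCongr w w.symm).trans (Equiv.sumComm _ _)

/-- The faces of the rotation system: the cycles (fixed points included) of the permutation
`rotation ∘ opposite`. -/
def Face {n : ℕ} (w : OutPort n ≃ InPort n) : Type :=
  Quotient (Equiv.Perm.SameCycle.setoid (rotation n * opposite w))

/-- `Feeds w u v`: some wire leads from an output of `u` to an input of `v`. -/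
def Feeds {n : ℕ} (w : OutPort n ≃ InPort n) (u v : Op n) : Prop :=
  ∃ x ∈ u.outputs, w x ∈ v.inputs

/-- A PC prograph of size `n` with named operators: a connected, oriented graph without
(directed) cycles on `n` coproducts and `n` products, whose drawing is planar. Planarity is
Euler's formula `V + F = E + 2` for the closed-up graph, which has `2 n + 1` vertices (the
additional one included) and `3 n + 1` edges. Since there are no cycles, for `n ≥ 1` the global
input is plugged into a coproduct and the global output comes from a product. -/
@[ext]
structure Named (n : ℕ) : Type where
  /-- The input into which each output is plugged. -/
  wire : OutPort n ≃ InPort n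
  connected : (SimpleGraph.fromRel (Feeds wire)).Preconnected
  acyclic : ∀ v, ¬ Relation.TransGen (Feeds wire) v v
  planar : (2 * n + 1) + Nat.card (Face wire) = (3 * n + 1) + 2

/-! ### Renaming the operators -/

/-- Renaming of coproducts and products. -/
def Op.map {n : ℕ} (σ τ : Equiv.Perm (Fin n)) : Op n → Op n
  | .cop c => .cop (σ c)
  | .prod p => .prod (τ p)

/-- Renaming of coproducts and products. -/
def OutPort.map {n : ℕ} (σ τ : Equiv.Perm (Fin n)) : OutPort n → OutPort n
  | .source => .source
  | .copLeft c => .copLeft (σ c)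
  | .copRight c => .copRight (σ c)
  | .prodOut p => .prodOut (τ p)

/-- Renaming of coproducts and products. -/
def InPort.map {n : ℕ} (σ τ : Equiv.Perm (Fin n)) : InPort n → InPort n
  | .sink => .sink
  | .copIn c => .copIn (σ c)
  | .prodLeft p => .prodLeft (τ p)
  | .prodRight p => .prodRight (τ p)

/-- `G` and `H` differ only by the names of the operators. -/
def Iso {n : ℕ} (G H : Named n) : Prop :=
  ∃ σ τ : Equiv.Perm (Fin n), ∀ x, H.wire (x.map σ τ) = (G.wire x).map σ τ

theorem iso_refl {n : ℕ} (G : Named n) : Iso G G := by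
  refine ⟨1, 1, fun x => ?_⟩
  have h1 : x.map 1 1 = x := by cases x <;> rfl
  have h2 : ∀ y : InPort n, y.map 1 1 = y := fun y => by cases y <;> rfl
  rw [h1, h2]

theorem iso_symm {n : ℕ} {G H : Named n} (h : Iso G H) : Iso H G := by
  obtain ⟨σ, τ, h⟩ := h
  refine ⟨σ⁻¹, τ⁻¹, fun x => ?_⟩
  have h1 : (x.map σ⁻¹ τ⁻¹).map σ τ = x := by cases x <;> simp [OutPort.map]
  have h2 : ∀ y : InPort n, (y.map σ τ).map σ⁻¹ τ⁻¹ = y := fun y => by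
    cases y <;> simp [InPort.map]
  have h3 := h (x.map σ⁻¹ τ⁻¹)
  rw [h1] at h3
  rw [h3, h2]

theorem iso_trans {n : ℕ} {G H K : Named n} (h : Iso G H) (k : Iso H K) : Iso G K := by
  obtain ⟨σ, τ, h⟩ := h
  obtain ⟨σ', τ', k⟩ := k
  refine ⟨σ' * σ, τ' * τ, fun x => ?_⟩
  have h1 : x.map (σ' * σ) (τ' * τ) = (x.map σ τ).map σ' τ' := by cases x <;> rfl
  have h2 : ∀ y : InPort n, y.map (σ' * σ) (τ' * τ) = (y.map σ τ).map σ' τ' := fun y => by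
    cases y <;> rfl
  rw [h1, h2, k, h]

/-- Equality of prographs up to the names of the operators. -/
instance isoSetoid (n : ℕ) : Setoid (Named n) where
  r := Iso
  iseqv := ⟨iso_refl, iso_symm, iso_trans⟩

/-! ### The labelling of the operators

Operators are labelled from bottom to top and from left to right: the next label goes to the
leftmost operator all of whose entries come from operators that are already labelled (or from
the global input). The state is the list, from left to right, of the open wires, i.e. those
that leave the part that is already labelled; each wire is named by the place where it starts. -/

namespace Named

/-- All entries of `v` are open wires. -/
def Ready {n : ℕ} (G : Named n) (F : List (OutPort n)) (v : Op n) : Prop :=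
  ∀ y ∈ v.inputs, G.wire.symm y ∈ F

instance {n : ℕ} (G : Named n) (F : List (OutPort n)) : DecidablePred (G.Ready F) :=
  fun v => inferInstanceAs (Decidable (∀ y ∈ v.inputs, G.wire.symm y ∈ F))

/-- The leftmost operator that is ready. -/
def leftmostReady {n : ℕ} (G : Named n) (F : List (OutPort n)) : Option (Op n) :=
  (F.filterMap (fun x => (G.wire x).owner)).find? (fun v => decide (G.Ready F v))

/-- The open wires after `v` has been labelled: the leftmost entry of `v` is replaced by the
outputs of `v`, and its other entry, if there is one, disappears. -/
def advance {n : ℕ} (G : Named n) (F : List (OutPort n)) (v : Op n) : List (OutPort n) :=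
  F.flatMap (fun x =>
    if v.inputs.head? = some (G.wire x) then v.outputs
    else if G.wire x ∈ v.inputs then []
    else [x])

/-- The operators that get the next `k` labels, in order, when the open wires are `F`. -/
def labelFrom {n : ℕ} (G : Named n) : ℕ → List (OutPort n) → List (Op n)
  | 0, _ => []
  | k + 1, F =>
    match G.leftmostReady F with
    | none => []
    | some v => v :: G.labelFrom k (G.advance F v)

/-- The operators in the order of their labels `1, 2, …, 2 n`. -/
def labelling {n : ℕ} (G : Named n) : List (Op n) :=
  G.labelFrom (2 * n) [OutPort.source]

/-- The operator `v` receives the label `i` (labels start at `1`). -/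
def HasLabel {n : ℕ} (G : Named n) (v : Op n) (i : ℕ) : Prop :=
  1 ≤ i ∧ G.labelling[i - 1]? = some v

/-- The labels of the coproducts are `1, …, n`, those of the products are `n + 1, …, 2 n`. -/
def CoproductsFirst {n : ℕ} (G : Named n) : Prop :=
  (∀ c : Fin n, ∃ i ∈ Finset.Icc 1 n, G.HasLabel (.cop c) i) ∧
    (∀ p : Fin n, ∃ i ∈ Finset.Icc (n + 1) (2 * n), G.HasLabel (.prod p) i)

end Named

/-! The labelling does not depend on the names of the operators. -/

section Invariance

variable {n : ℕ} {G H : Named n} {σ τ : Equiv.Perm (Fin n)}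

theorem OutPort.map_injective : Function.Injective (OutPort.map (n := n) σ τ) := by
  intro x y h
  cases x <;> cases y <;> simp_all [OutPort.map]

theorem InPort.map_injective : Function.Injective (InPort.map (n := n) σ τ) := by
  intro x y h
  cases x <;> cases y <;> simp_all [InPort.map]

theorem inputs_map (v : Op n) : (v.map σ τ).inputs = v.inputs.map (InPort.map σ τ) := by
  cases v <;> rfl

theorem outputs_map (v : Op n) : (v.map σ τ).outputs = v.outputs.map (OutPort.map σ τ) := by
  cases v <;> rfl

theorem owner_map (y : InPort n) : (y.map σ τ).owner = y.owner.map (Op.map σ τ) := by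
  cases y <;> rfl

theorem ready_map (h : ∀ x, H.wire (x.map σ τ) = (G.wire x).map σ τ) (F : List (OutPort n))
    (v : Op n) : H.Ready (F.map (OutPort.map σ τ)) (v.map σ τ) ↔ G.Ready F v := by
  have h' : ∀ y, H.wire.symm (y.map σ τ) = (G.wire.symm y).map σ τ := fun y => by
    rw [Equiv.symm_apply_eq, h, Equiv.apply_symm_apply]
  simp only [Named.Ready, inputs_map, List.forall_mem_map, h',
    List.mem_map_of_injective OutPort.map_injective]

theorem leftmostReady_map (h : ∀ x, H.wire (x.map σ τ) = (G.wire x).map σ τ)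
    (F : List (OutPort n)) :
    H.leftmostReady (F.map (OutPort.map σ τ)) = (G.leftmostReady F).map (Op.map σ τ) := by
  have h1 : (F.map (OutPort.map σ τ)).filterMap (fun x => (H.wire x).owner) =
      (F.filterMap (fun x => (G.wire x).owner)).map (Op.map σ τ) := by
    rw [List.filterMap_map, List.map_filterMap]
    congr 1
    funext x
    simp [h, owner_map]
  unfold Named.leftmostReady
  rw [h1, List.find?_map]
  congr 2
  funext v
  simp [ready_map h]

theorem advance_map (h : ∀ x, H.wire (x.map σ τ) = (G.wire x).map σ τ) (F : List (OutPort n))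
    (v : Op n) : H.advance (F.map (OutPort.map σ τ)) (v.map σ τ) =
      (G.advance F v).map (OutPort.map σ τ) := by
  unfold Named.advance
  rw [List.flatMap_map, List.map_flatMap]
  congr 1
  funext x
  have h1 : (v.map σ τ).inputs.head? = some (H.wire (x.map σ τ)) ↔
      v.inputs.head? = some (G.wire x) := by
    rw [inputs_map, h, List.head?_map, ← Option.map_some]
    exact (Option.map_injective InPort.map_injective).eq_iff
  have h2 : H.wire (x.map σ τ) ∈ (v.map σ τ).inputs ↔ G.wire x ∈ v.inputs := by
    rw [inputs_map, h, List.mem_map_of_injective InPort.map_injective]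
  simp only [h1, h2]
  split_ifs <;> simp [outputs_map]

theorem labelFrom_map (h : ∀ x, H.wire (x.map σ τ) = (G.wire x).map σ τ) (k : ℕ)
    (F : List (OutPort n)) :
    H.labelFrom k (F.map (OutPort.map σ τ)) = (G.labelFrom k F).map (Op.map σ τ) := by
  induction k generalizing F with
  | zero => rfl
  | succ k ih =>
    simp only [Named.labelFrom]
    rw [leftmostReady_map h]
    cases G.leftmostReady F with
    | none => rfl
    | some v => simp [advance_map h, ih]

theorem labelling_map (h : ∀ x, H.wire (x.map σ τ) = (G.wire x).map σ τ) :
    H.labelling = G.labelling.map (Op.map σ τ) :=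
  labelFrom_map h (2 * n) [OutPort.source]

theorem coproductsFirst_of_iso (h : Iso G H) (hG : G.CoproductsFirst) : H.CoproductsFirst := by
  obtain ⟨σ, τ, h⟩ := h
  have key : ∀ v i, G.HasLabel v i → H.HasLabel (v.map σ τ) i := by
    rintro v i ⟨h1, h2⟩
    refine ⟨h1, ?_⟩
    rw [labelling_map h, List.getElem?_map, h2]
    rfl
  constructor
  · intro c
    obtain ⟨i, hi, hl⟩ := hG.1 (σ.symm c)
    refine ⟨i, hi, ?_⟩
    simpa [Op.map] using key _ i hl
  · intro p
    obtain ⟨i, hi, hl⟩ := hG.2 (τ.symm p)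
    refine ⟨i, hi, ?_⟩
    simpa [Op.map] using key _ i hl

end Invariance

end PCPrograph

/-- PC prographs of size `n`. -/
def PCPrograph (n : ℕ) : Type := Quotient (PCPrograph.isoSetoid n)

/-- The labels of the coproducts are `1, …, n`, those of the products are `n + 1, …, 2 n`. -/
def PCPrograph.CoproductsFirst {n : ℕ} (P : PCPrograph n) : Prop :=
  Quotient.lift (fun G : PCPrograph.Named n => G.CoproductsFirst)
    (fun _ _ h => propext ⟨PCPrograph.coproductsFirst_of_iso h,
      PCPrograph.coproductsFirst_of_iso (PCPrograph.iso_symm h)⟩) P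

/-! ## Disabled grafting sites of binary trees -/

/-- The number of leaves to the left of the last node, where the nodes are listed by the
depth-left-first search (root, then left subtree, then right subtree). The last node lies in the
right subtree if that has a node, otherwise in the left subtree if that has a node, and
otherwise it is the root, with no leaf to its left. -/
def disabledSites : BinaryTree Unit → ℕ
  | .nil => 0
  | .node _ l .nil => disabledSites l
  | .node _ l (.node a r₁ r₂) => l.numLeaves + disabledSites (.node a r₁ r₂)

/-- The sum of `q ^ disabledSites T` over the binary trees `T` with `n` nodes. -/
noncomputable def catPoly (n : ℕ) : Polynomial ℤ :=
  ∑ T ∈ BinaryTree.treesOfNumNodesEq n, Polynomial.X ^ disabledSites T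

/-- The coefficient `C(n, k)` of `q ^ k` in `catPoly n`. For `n ≥ 1`, these are the entries of a row
`1, n - 1, …` of the Catalan triangle. -/
noncomputable def catTriangle (n k : ℕ) : ℤ := (catPoly n).coeff k

/-- The binomial coefficient with an integer lower index; it is zero if that is negative. -/
def binom (a : ℕ) (k : ℤ) : ℤ := if 0 ≤ k then (a.choose k.toNat : ℤ) else 0

/-! ## Counting trees by disabled grafting sites -/

section Trees

open BinaryTree

/-! Sweep the prograph from bottom to top in the order of the labels and keep the list of open
wires. Planarity makes the inputs of the next operator consecutive in this list, so the prograph is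
recorded by the positions `f i` at which its operators are plugged in (`codeFrontier`, `Realizes`).
That the leftmost ready operator always comes first amounts to a local condition: the inputs of an
operator never lie entirely to the left of those of its predecessor (`IsCode.step`; sufficient by
`Splits.notMem_left`, necessary by `Named.isCode_code`).

When the coproducts come first, their positions form a weakly increasing sequence with `f k ≤ k`.
For the products, read from top to bottom, the numbers of open wires to the right of the inputs form
another such sequence. The condition between the last coproduct and the first product says that the
two final entries have sum at most `n` (`isCode_iff`, `codeEquiv`). On the side of the trees,
removing the last node is inverse to grafting it back at leaf `dg`, and grafting at leaf `k` creates
a last node exactly when `k` is not disabled. So trees with `dg = k` obey the same recursion as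
ballot sequences that end in `k` (`card_treesWithSites_succ`, `card_ballotSeqs`).

Euler's formula is used through colours of regions. In an acyclic wiring every face is one of the
two outer ones or starts above some coproduct, so there are at most `n + 2` faces
(`nameFace_surjective`), and planarity says that these are distinct. Distinctness makes the inputs
of a product adjacent (`ClosedColoring.exists_append`). Conversely, the wiring built from a code has
a colouring that separates the named faces (`RegionColoring.closed`, `ClosedColoring.planar`).

The closed form is a coefficient extraction from `(1 - 2X)² / (1 - X)^(2n + 3)`, where a row of the
Catalan triangle comes from `(1 - 2X) / (1 - X)^(n + 1)` (`sum_catTriangle_mul`). -/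

/-- Replace the leaf with index `k` (from left to right, from `0`) by a node. -/
def graftAt : BinaryTree Unit → ℕ → BinaryTree Unit
  | .nil, _ => .node () .nil .nil
  | .node a l r, k =>
    if k < l.numLeaves then .node a (graftAt l k) r else .node a l (graftAt r (k - l.numLeaves))

/-- Replace the last node (which carries two leaves) by a leaf. -/
def pruneLast : BinaryTree Unit → BinaryTree Unit
  | .nil => .nil
  | .node _ .nil .nil => .nil
  | .node a (.node b l₁ l₂) .nil => .node a (pruneLast (.node b l₁ l₂)) .nil
  | .node a l (.node b r₁ r₂) => .node a l (pruneLast (.node b r₁ r₂))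

theorem pruneLast_node_nil {a : Unit} {l : BinaryTree Unit} (h : l ≠ .nil) :
    pruneLast (.node a l .nil) = .node a (pruneLast l) .nil := by
  cases l <;> simp_all [pruneLast]

theorem pruneLast_node {a : Unit} {l r : BinaryTree Unit} (h : r ≠ .nil) :
    pruneLast (.node a l r) = .node a l (pruneLast r) := by
  cases r <;> simp_all [pruneLast]

theorem disabledSites_node_nil (a : Unit) (l : BinaryTree Unit) :
    disabledSites (.node a l .nil) = disabledSites l := by
  cases l <;> simp [disabledSites]

theorem disabledSites_node {a : Unit} {l r : BinaryTree Unit} (h : r ≠ .nil) :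
    disabledSites (.node a l r) = l.numLeaves + disabledSites r := by
  cases r <;> simp_all [disabledSites]

/-- A tree has one leaf more than it has nodes, and the two leaves carried by the last node are not
to its left. -/
theorem disabledSites_lt {T : BinaryTree Unit} (h : T ≠ .nil) : disabledSites T < T.numNodes := by
  induction T with
  | nil => exact absurd rfl h
  | node a l r ihl ihr =>
    by_cases hr : r = .nil
    · subst hr
      rw [disabledSites_node_nil]
      by_cases hl : l = .nil
      · subst hl; simp [disabledSites, numNodes]
      · have := ihl hl
        simp only [numNodes]; omega
    · rw [disabledSites_node hr, numLeaves_eq_numNodes_succ]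
      have := ihr hr
      simp only [numNodes]; omega

theorem disabledSites_le (T : BinaryTree Unit) : disabledSites T ≤ T.numNodes := by
  cases T with
  | nil => simp [disabledSites]
  | node a l r => exact (disabledSites_lt (by simp)).le

theorem graftAt_ne_nil (T : BinaryTree Unit) (k : ℕ) : graftAt T k ≠ .nil := by
  cases T with
  | nil => simp [graftAt]
  | node a l r => rw [graftAt]; split_ifs <;> simp

theorem numNodes_graftAt (T : BinaryTree Unit) (k : ℕ) :
    (graftAt T k).numNodes = T.numNodes + 1 := by
  induction T generalizing k with
  | nil => simp [graftAt, numNodes]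
  | node a l r ihl ihr =>
    rw [graftAt]
    split_ifs
    · simp only [numNodes, ihl]; omega
    · simp only [numNodes, ihr]; omega

theorem numNodes_pruneLast {T : BinaryTree Unit} (h : T ≠ .nil) :
    (pruneLast T).numNodes + 1 = T.numNodes := by
  induction T with
  | nil => exact absurd rfl h
  | node a l r ihl ihr =>
    by_cases hr : r = .nil
    · subst hr
      by_cases hl : l = .nil
      · subst hl; simp [pruneLast, numNodes]
      · rw [pruneLast_node_nil hl]
        have := ihl hl
        simp only [numNodes]; omega
    · rw [pruneLast_node hr]
      have := ihr hr
      simp only [numNodes]; omega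

/-- The leaves from index `disabledSites T` on are those carried by the last node or to the right of
it. A node grafted there comes last in the search and has the `k` preceding leaves to its left. -/
theorem disabledSites_graftAt {T : BinaryTree Unit} {k : ℕ} (h : disabledSites T ≤ k)
    (hk : k ≤ T.numNodes) : disabledSites (graftAt T k) = k := by
  induction T generalizing k with
  | nil => simp [numNodes] at hk; subst hk; simp [graftAt, disabledSites]
  | node a l r ihl ihr =>
    have hl := l.numLeaves_eq_numNodes_succ
    simp only [numNodes] at hk
    rw [graftAt]
    split_ifs with hlt
    · by_cases hr : r = .nil
      · subst hr
        rw [disabledSites_node_nil] at h ⊢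
        exact ihl h (by omega)
      · rw [disabledSites_node hr] at h
        omega
    · rw [disabledSites_node (graftAt_ne_nil _ _), ihr _ (by omega)]
      · omega
      · by_cases hr : r = .nil
        · subst hr; simp [disabledSites]
        · rw [disabledSites_node hr] at h
          omega

theorem disabledSites_pruneLast (T : BinaryTree Unit) :
    disabledSites (pruneLast T) ≤ disabledSites T := by
  induction T with
  | nil => simp [pruneLast]
  | node a l r ihl ihr =>
    by_cases hr : r = .nil
    · subst hr
      by_cases hl : l = .nil
      · subst hl; simp [pruneLast, disabledSites]
      · rw [pruneLast_node_nil hl, disabledSites_node_nil, disabledSites_node_nil]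
        exact ihl
    · rw [pruneLast_node hr, disabledSites_node hr]
      -- If the right subtree disappears, the new last node is in `l` or is the root, so the count
      -- drops below `l.numLeaves`.
      by_cases hp : pruneLast r = .nil
      · rw [hp, disabledSites_node_nil, numLeaves_eq_numNodes_succ]
        have := disabledSites_le l
        omega
      · rw [disabledSites_node hp]
        omega

theorem pruneLast_graftAt {T : BinaryTree Unit} {k : ℕ} (h : disabledSites T ≤ k)
    (hk : k ≤ T.numNodes) : pruneLast (graftAt T k) = T := by
  induction T generalizing k with
  | nil => simp [graftAt, pruneLast]
  | node a l r ihl ihr =>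
    have hl := l.numLeaves_eq_numNodes_succ
    simp only [numNodes] at hk
    rw [graftAt]
    split_ifs with hlt
    · by_cases hr : r = .nil
      · subst hr
        rw [disabledSites_node_nil] at h
        rw [pruneLast_node_nil (graftAt_ne_nil _ _), ihl h (by omega)]
      · rw [disabledSites_node hr] at h
        omega
    · rw [pruneLast_node (graftAt_ne_nil _ _), ihr _ (by omega)]
      by_cases hr : r = .nil
      · subst hr; simp [disabledSites]
      · rw [disabledSites_node hr] at h
        omega

theorem graftAt_pruneLast {T : BinaryTree Unit} (h : T ≠ .nil) :
    graftAt (pruneLast T) (disabledSites T) = T := by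
  induction T with
  | nil => exact absurd rfl h
  | node a l r ihl ihr =>
    by_cases hr : r = .nil
    · subst hr
      by_cases hl : l = .nil
      · subst hl; simp [pruneLast, graftAt]
      · rw [pruneLast_node_nil hl, disabledSites_node_nil, graftAt, if_pos, ihl hl]
        rw [numLeaves_eq_numNodes_succ, numNodes_pruneLast hl]
        exact disabledSites_lt hl
    · rw [pruneLast_node hr, disabledSites_node hr, graftAt, if_neg (by omega),
        Nat.add_sub_cancel_left, ihr hr]

/-- The binary trees with `n` nodes and `k` disabled grafting sites. -/
def treesWithSites (n k : ℕ) : Finset (BinaryTree Unit) :=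
  (treesOfNumNodesEq n).filter (fun T => disabledSites T = k)

theorem mem_treesWithSites {n k : ℕ} {T : BinaryTree Unit} :
    T ∈ treesWithSites n k ↔ T.numNodes = n ∧ disabledSites T = k := by
  simp [treesWithSites, mem_treesOfNumNodesEq]

theorem catTriangle_eq_card (n k : ℕ) : catTriangle n k = (treesWithSites n k).card := by
  simp only [catTriangle, catPoly, Polynomial.finsetSum_coeff, Polynomial.coeff_X_pow,
    treesWithSites, Finset.card_filter, Nat.cast_sum, Nat.cast_ite, Nat.cast_one, Nat.cast_zero,
    eq_comm]

theorem card_filter_le_eq_sum {α : Type*} (s : Finset α) (f : α → ℕ) (k : ℕ) :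
    (s.filter (fun a => f a ≤ k)).card =
      ∑ d ∈ Finset.range (k + 1), (s.filter (fun a => f a = d)).card := by
  rw [Finset.card_eq_sum_card_fiberwise (f := f) (t := Finset.range (k + 1))]
  · refine Finset.sum_congr rfl fun d hd => ?_
    rw [Finset.filter_filter]
    congr 1
    ext a
    simp only [Finset.mem_filter, Finset.mem_range] at *
    constructor
    · rintro ⟨h1, h2, h3⟩; exact ⟨h1, h3⟩
    · rintro ⟨h1, h2⟩; exact ⟨h1, by omega, h2⟩
  · intro a ha
    simp at ha ⊢
    omega

theorem card_treesWithSites_zero (k : ℕ) :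
    (treesWithSites 0 k).card = if k = 0 then 1 else 0 := by
  rw [treesWithSites, treesOfNumNodesEq_zero, Finset.filter_singleton]
  simp only [disabledSites, eq_comm]
  split_ifs <;> rfl

/-- `pruneLast` and grafting at leaf `k` are mutually inverse between the trees with `dg = k` and
the trees with one node less and `dg ≤ k`. -/
theorem card_treesWithSites_succ (n k : ℕ) : (treesWithSites (n + 1) k).card =
    if k ≤ n then ∑ d ∈ Finset.range (k + 1), (treesWithSites n d).card else 0 := by
  split_ifs with hk
  · simp only [treesWithSites]
    rw [← card_filter_le_eq_sum]
    have hne : ∀ T : BinaryTree Unit, T.numNodes = n + 1 → T ≠ .nil := by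
      rintro T hT rfl
      simp [numNodes] at hT
    refine Finset.card_nbij' pruneLast (graftAt · k) ?_ ?_ ?_ ?_
    · intro T hT
      simp only [Finset.coe_filter, mem_treesOfNumNodesEq, Set.mem_ofPred_eq] at hT ⊢
      have h1 := numNodes_pruneLast (hne T hT.1)
      have h2 := disabledSites_pruneLast T
      omega
    · intro T hT
      simp only [Finset.coe_filter, mem_treesOfNumNodesEq, Set.mem_ofPred_eq] at hT ⊢
      exact ⟨by rw [numNodes_graftAt, hT.1], disabledSites_graftAt hT.2 (by omega)⟩
    · intro T hT
      simp only [Finset.coe_filter, mem_treesOfNumNodesEq, Set.mem_ofPred_eq] at hT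
      dsimp only
      rw [← hT.2]
      exact graftAt_pruneLast (hne T hT.1)
    · intro T hT
      simp only [Finset.coe_filter, mem_treesOfNumNodesEq, Set.mem_ofPred_eq] at hT
      exact pruneLast_graftAt hT.2 (by omega)
  · rw [Finset.card_eq_zero, Finset.eq_empty_iff_forall_notMem]
    intro T hT
    rw [mem_treesWithSites] at hT
    have := disabledSites_lt (T := T) (by rintro rfl; simp [numNodes] at hT)
    omega

end Trees

/-! ## Ballot sequences -/

/-- The sequences with `p i ≤ i` that increase weakly for `i < n` and vanish from `n` on. -/
noncomputable def ballotSeqs : ℕ → Finset (ℕ → ℕ)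
  | 0 => {0}
  | n + 1 => by
    classical
    exact (ballotSeqs n).biUnion fun p => (Finset.Icc (p (n - 1)) n).image (Function.update p n)

theorem mem_ballotSeqs {n : ℕ} {p : ℕ → ℕ} : p ∈ ballotSeqs n ↔
    (∀ i, n ≤ i → p i = 0) ∧ (∀ i < n, p i ≤ i) ∧ ∀ i, i + 1 < n → p i ≤ p (i + 1) := by
  classical
  induction n generalizing p with
  | zero => simp [ballotSeqs, funext_iff]
  | succ n ih =>
    simp only [ballotSeqs, Finset.mem_biUnion, Finset.mem_image, Finset.mem_Icc]
    constructor
    · rintro ⟨p, hp, d, ⟨hd, hdn⟩, rfl⟩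
      obtain ⟨h1, h2, h3⟩ := ih.1 hp
      refine ⟨fun i hi => ?_, fun i hi => ?_, fun i hi => ?_⟩
      · rw [Function.update_of_ne (by omega)]
        exact h1 i (by omega)
      · by_cases hin : i = n
        · subst hin; simpa
        · rw [Function.update_of_ne hin]
          exact h2 i (by omega)
      · rw [Function.update_of_ne (by omega)]
        by_cases hin : i + 1 = n
        · subst hin; simpa using hd
        · rw [Function.update_of_ne hin]
          exact h3 i (by omega)
    · rintro ⟨h1, h2, h3⟩
      refine ⟨Function.update p n 0, ih.2 ⟨fun i hi => ?_, fun i hi => ?_, fun i hi => ?_⟩, p n,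
        ⟨?_, h2 n (by omega)⟩, by simp⟩
      · by_cases hin : i = n
        · subst hin; simp
        · rw [Function.update_of_ne hin]
          exact h1 i (by omega)
      · rw [Function.update_of_ne (by omega)]
        exact h2 i (by omega)
      · rw [Function.update_of_ne (by omega), Function.update_of_ne (by omega)]
        exact h3 i (by omega)
      -- For `n = 0` the truncated index `n - 1` is `0`, where the updated function vanishes.
      · rcases n with _ | n
        · simp
        · rw [Function.update_of_ne (by omega)]
          exact h3 n (by omega)

/-- Erasing the last entry `k` leaves a shorter sequence whose last entry is at most `k`: this is
the recursion of the trees. -/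
theorem card_ballotSeqs (n k : ℕ) : ((ballotSeqs n).filter (fun p => p (n - 1) = k)).card =
    (treesWithSites n k).card := by
  classical
  induction n generalizing k with
  | zero =>
    rw [card_treesWithSites_zero, ballotSeqs, Finset.filter_singleton]
    simp only [Pi.zero_apply, eq_comm]
    split_ifs <;> rfl
  | succ n ih =>
    rw [card_treesWithSites_succ]
    split_ifs with hk
    · simp only [← ih]
      rw [← card_filter_le_eq_sum]
      refine Finset.card_nbij' (Function.update · n 0) (Function.update · n k) ?_ ?_ ?_ ?_
      · intro p hp
        simp only [Finset.coe_filter, Set.mem_ofPred_eq, ballotSeqs, Finset.mem_biUnion,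
          Finset.mem_image, Finset.mem_Icc] at hp ⊢
        obtain ⟨⟨p, hp, d, ⟨hd, hdn⟩, rfl⟩, hdk⟩ := hp
        have h0 : p n = 0 := (mem_ballotSeqs.1 hp).1 n le_rfl
        have h1 : Function.update p n 0 = p := by rw [← h0]; simp
        rw [Function.update_idem, h1]
        simp at hdk
        exact ⟨hp, by omega⟩
      · intro p hp
        simp only [Finset.coe_filter, Set.mem_ofPred_eq, ballotSeqs, Finset.mem_biUnion,
          Finset.mem_image, Finset.mem_Icc] at hp ⊢
        exact ⟨⟨p, hp.1, k, ⟨hp.2, hk⟩, rfl⟩, by simp⟩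
      · intro p hp
        simp only [Finset.coe_filter, Set.mem_ofPred_eq] at hp
        simp [← hp.2]
      · intro p hp
        simp only [Finset.coe_filter, Set.mem_ofPred_eq] at hp
        have h0 : p n = 0 := (mem_ballotSeqs.1 hp.1).1 n le_rfl
        dsimp only
        rw [Function.update_idem, ← h0]
        simp
    · rw [Finset.card_eq_zero, Finset.eq_empty_iff_forall_notMem]
      intro p hp
      rw [Finset.mem_filter, mem_ballotSeqs] at hp
      have := hp.1.2.1 n (by omega)
      have := hp.2
      simp at this
      omega

/-! ### Pairs of trees and pairs of ballot sequences -/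

/-- Counting the pairs with bounded sum of weights by the weights. -/
theorem card_pairs_eq_sum {α : Type*} (s : Finset α) (f : α → ℕ) (n : ℕ) :
    ((s ×ˢ s).filter (fun a => f a.1 + f a.2 ≤ n)).card =
      ∑ d ∈ Finset.range (n + 1) ×ˢ Finset.range (n + 1) with d.1 + d.2 ≤ n,
        (s.filter (fun a => f a = d.1)).card * (s.filter (fun a => f a = d.2)).card := by
  rw [Finset.card_eq_sum_card_fiberwise (f := fun a => (f a.1, f a.2))
    (t := (Finset.range (n + 1) ×ˢ Finset.range (n + 1)).filter fun d => d.1 + d.2 ≤ n)]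
  · refine Finset.sum_congr rfl fun d hd => ?_
    rw [← Finset.card_product]
    congr 1
    ext a
    simp only [Finset.mem_filter, Finset.mem_product, Finset.mem_range, Prod.ext_iff] at hd ⊢
    constructor
    · rintro ⟨⟨⟨h1, h2⟩, h3⟩, h4, h5⟩
      exact ⟨⟨h1, h4⟩, h2, h5⟩
    · rintro ⟨⟨h1, h4⟩, h2, h5⟩
      exact ⟨⟨⟨h1, h2⟩, by omega⟩, h4, h5⟩
  · intro a ha
    simp at ha ⊢
    omega

theorem card_treePairs (n : ℕ) :
    (Nat.card {T : BinaryTree Unit × BinaryTree Unit // T.1.numNodes = n ∧ T.2.numNodes = n ∧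
      disabledSites T.1 + disabledSites T.2 ≤ n} : ℤ) =
      ∑ d ∈ Finset.range (n + 1) ×ˢ Finset.range (n + 1) with d.1 + d.2 ≤ n,
        catTriangle n d.1 * catTriangle n d.2 := by
  simp only [catTriangle_eq_card, treesWithSites, ← Nat.cast_mul, ← Nat.cast_sum]
  rw [← card_pairs_eq_sum, Nat.cast_inj]
  refine Nat.subtype_card _ fun T => ?_
  simp [BinaryTree.mem_treesOfNumNodesEq, and_assoc]

theorem card_ballotPairs (n : ℕ) :
    (Nat.card {p : (ℕ → ℕ) × (ℕ → ℕ) // (p.1 ∈ ballotSeqs n ∧ p.2 ∈ ballotSeqs n) ∧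
      p.1 (n - 1) + p.2 (n - 1) ≤ n} : ℤ) =
      ∑ d ∈ Finset.range (n + 1) ×ˢ Finset.range (n + 1) with d.1 + d.2 ≤ n,
        catTriangle n d.1 * catTriangle n d.2 := by
  simp only [catTriangle_eq_card, ← card_ballotSeqs, ← Nat.cast_mul, ← Nat.cast_sum]
  rw [← card_pairs_eq_sum, Nat.cast_inj]
  refine Nat.subtype_card _ fun p => ?_
  simp

/-! ## Closed forms -/

theorem binom_natCast (a k : ℕ) : binom a k = a.choose k := by simp [binom]

theorem binom_natCast_succ_sub_one (a k : ℕ) : binom a ((k + 1 : ℕ) - 1 : ℤ) = a.choose k := by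
  have : ((k + 1 : ℕ) - 1 : ℤ) = k := by push_cast; ring
  rw [this, binom_natCast]

theorem binom_of_neg (a : ℕ) {k : ℤ} (hk : k < 0) : binom a k = 0 := by
  simp [binom, not_le.2 hk]

/-- The ballot number as a difference of binomial coefficients. -/
def ballotNumber (n k : ℕ) : ℤ := binom (n + k) k - binom (n + k) ((k : ℤ) - 1)

theorem ballotNumber_zero (n : ℕ) : ballotNumber n 0 = 1 := by
  simp [ballotNumber, binom]

theorem ballotNumber_succ_succ (n k : ℕ) :
    ballotNumber (n + 1) (k + 1) = ballotNumber (n + 1) k + ballotNumber n (k + 1) := by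
  have e1 : n + 1 + (k + 1) = (n + k + 1) + 1 := by ring
  have e2 : n + 1 + k = n + k + 1 := by ring
  have e3 : n + (k + 1) = n + k + 1 := by ring
  simp only [ballotNumber, binom_natCast, binom_natCast_succ_sub_one, e1, e2, e3]
  rcases k with _ | k
  · simp [binom_of_neg]
    ring
  · rw [binom_natCast_succ_sub_one, Nat.choose_succ_succ' (n + (k + 1) + 1) (k + 1),
      Nat.choose_succ_succ' (n + (k + 1) + 1) k]
    push_cast
    ring

/-- By the symmetry of row `2 n + 1` of Pascal's triangle. This is the zero just beyond the end of a
row of the Catalan triangle. -/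
theorem ballotNumber_succ_self (n : ℕ) : ballotNumber n (n + 1) = 0 := by
  rw [ballotNumber, binom_natCast, binom_natCast_succ_sub_one, sub_eq_zero, Nat.cast_inj]
  rw [← Nat.choose_symm_of_eq_add]
  ring

/-- Partial sums of a row give the next row, which is the recurrence `ballotNumber_succ_succ`. The
range includes the zero after the last entry, since the partial sums for the next row reach it. -/
theorem catTriangle_succ_eq_ballotNumber {n k : ℕ} (hk : k ≤ n + 1) :
    catTriangle (n + 1) k = ballotNumber n k := by
  have key : ∀ n k : ℕ, catTriangle (n + 1) k =
      if k ≤ n then ∑ d ∈ Finset.range (k + 1), catTriangle n d else 0 := by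
    intro n k
    simp only [catTriangle_eq_card, card_treesWithSites_succ]
    push_cast
    rfl
  induction n generalizing k with
  | zero =>
    rw [key]
    obtain rfl | rfl : k = 0 ∨ k = 1 := by omega
    · simp [catTriangle_eq_card, card_treesWithSites_zero, ballotNumber_zero]
    · simp [ballotNumber_succ_self]
  | succ n ih =>
    rw [key]
    split_ifs with h
    · clear hk
      induction k with
      | zero => simp [ih, ballotNumber_zero]
      | succ k ihk =>
        rw [Finset.sum_range_succ, ihk (by omega), ih (by omega), ballotNumber_succ_succ]
    · obtain rfl : k = n + 1 + 1 := by omega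
      rw [ballotNumber_succ_self]

open PowerSeries in
theorem coeff_X_pow_mul_invOneSubPow (d j k : ℕ) :
    coeff k ((X : ℤ⟦X⟧) ^ j * (invOneSubPow ℤ (d + 1)).val) =
      if j ≤ k then ((d + (k - j)).choose (k - j) : ℤ) else 0 := by
  rw [coeff_X_pow_mul', invOneSubPow_val_succ_eq_mk_add_choose, coeff_mk]
  split_ifs
  · rw [Nat.choose_symm_add]
  · rfl

open PowerSeries in
-- Write `1 - 2X = (1 - X) - X`. The identity holds for all `k`, although these coefficients agree
-- with the Catalan triangle only up to the first zero.
theorem coeff_ballotNumber (n k : ℕ) :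
    coeff k ((1 - 2 * X : ℤ⟦X⟧) * (invOneSubPow ℤ (n + 2)).val) = ballotNumber n k := by
  have h : (1 - 2 * X : ℤ⟦X⟧) * (invOneSubPow ℤ (n + 2)).val =
      X ^ 0 * (invOneSubPow ℤ (n + 1)).val - X ^ 1 * (invOneSubPow ℤ (n + 1 + 1)).val := by
    rw [← one_sub_pow_mul_invOneSubPow_val_add_eq_invOneSubPow_val ℤ (n + 1) 1]
    ring
  rw [h, map_sub, coeff_X_pow_mul_invOneSubPow, coeff_X_pow_mul_invOneSubPow, ballotNumber,
    binom_natCast]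
  rcases k with _ | k
  · simp [binom_of_neg]
  · rw [binom_natCast_succ_sub_one]
    simp only [if_true, Nat.sub_zero, Nat.le_add_left, Nat.add_sub_cancel]
    congr 3
    ring

open PowerSeries in
theorem sum_catTriangle_mul (n : ℕ) :
    ∑ d ∈ Finset.range (n + 1) ×ˢ Finset.range (n + 1) with d.1 + d.2 ≤ n,
        catTriangle n d.1 * catTriangle n d.2 =
      binom (3 * n) n - 2 * binom (3 * n) ((n : ℤ) - 1) + binom (3 * n) ((n : ℤ) - 2) := by
  rcases n with _ | n
  · simp [catTriangle_eq_card, card_treesWithSites_zero, binom, Finset.sum_filter]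
  -- Only entries of degree at most `n + 1` contribute, and there `B` agrees with the row of size `n
  -- + 1`. Multiplication by `1 / (1 - X)` sums the coefficients of `B * B` over all total degrees
  -- up to `n + 1`.
  set B : ℤ⟦X⟧ := (1 - 2 * X) * (invOneSubPow ℤ (n + 2)).val with hB
  have h1 : ∑ d ∈ Finset.range (n + 2) ×ˢ Finset.range (n + 2) with d.1 + d.2 ≤ n + 1,
        catTriangle (n + 1) d.1 * catTriangle (n + 1) d.2 =
      coeff (n + 1) (B * B * (invOneSubPow ℤ 1).val) := by
    rw [invOneSubPow_val_succ_eq_mk_add_choose, coeff_mul]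
    simp only [coeff_mk, zero_add, Nat.choose_zero_right, Nat.cast_one, mul_one]
    rw [Finset.Nat.sum_antidiagonal_eq_sum_range_succ (fun i _ => coeff i (B * B)),
      Finset.sum_congr rfl fun i _ => coeff_mul i B B,
      ← Finset.sum_fiberwise_of_maps_to
        (s := (Finset.range (n + 2) ×ˢ Finset.range (n + 2)).filter fun d => d.1 + d.2 ≤ n + 1)
        (g := fun d => d.1 + d.2) (t := Finset.range (n + 1 + 1))]
    · refine Finset.sum_congr rfl fun i hi => Finset.sum_congr ?_ ?_
      · ext d
        simp only [Finset.mem_filter, Finset.mem_product, Finset.mem_range,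
          Finset.HasAntidiagonal.mem_antidiagonal] at hi ⊢
        omega
      · intro d hd
        simp only [Finset.HasAntidiagonal.mem_antidiagonal, Finset.mem_range] at hd hi
        rw [hB, coeff_ballotNumber, coeff_ballotNumber,
          catTriangle_succ_eq_ballotNumber (by omega), catTriangle_succ_eq_ballotNumber (by omega)]
    · intro d hd
      simp only [Finset.mem_filter, Finset.mem_range] at hd ⊢
      omega
  -- The expansion `(1 - 2X)² = (1 - X)² - 2X(1 - X) + X²` yields the three binomial coefficients.
  have h2 : B * B * (invOneSubPow ℤ 1).val = X ^ 0 * (invOneSubPow ℤ (2 * n + 2 + 1)).val -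
      2 * (X ^ 1 * (invOneSubPow ℤ (2 * n + 3 + 1)).val) +
      X ^ 2 * (invOneSubPow ℤ (2 * n + 4 + 1)).val := by
    have e1 : (invOneSubPow ℤ (n + 2)).val * (invOneSubPow ℤ (n + 2)).val *
        (invOneSubPow ℤ 1).val = (invOneSubPow ℤ (2 * n + 4 + 1)).val := by
      rw [← Units.val_mul, ← Units.val_mul, ← invOneSubPow_add, ← invOneSubPow_add]
      congr 2
      ring
    have e2 := one_sub_pow_mul_invOneSubPow_val_add_eq_invOneSubPow_val ℤ (2 * n + 4) 1
    have e3 := one_sub_pow_mul_invOneSubPow_val_add_eq_invOneSubPow_val ℤ (2 * n + 3) 2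
    rw [show 2 * n + 3 + 2 = 2 * n + 4 + 1 by ring] at e3
    rw [show 2 * n + 3 + 1 = 2 * n + 4 by ring, show 2 * n + 2 + 1 = 2 * n + 3 by ring,
      ← e2, ← e3, hB]
    linear_combination (1 - 2 * X : ℤ⟦X⟧) ^ 2 * e1
  have h3 : (2 : ℤ⟦X⟧) = C (2 : ℤ) := by simp
  rw [h1, h2, map_add, map_sub, h3, coeff_C_mul, coeff_X_pow_mul_invOneSubPow,
    coeff_X_pow_mul_invOneSubPow, coeff_X_pow_mul_invOneSubPow, binom_natCast,
    binom_natCast_succ_sub_one]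
  rcases n with _ | n
  · simp [binom_of_neg]
  · have e : ((n + 1 + 1 : ℕ) : ℤ) - 2 = n := by push_cast; ring
    rw [e, binom_natCast, if_pos (by omega), if_pos (by omega), if_pos (by omega)]
    have e1 : 2 * (n + 1) + 2 + (n + 1 + 1 - 0) = 3 * (n + 1 + 1) := by omega
    have e2 : 2 * (n + 1) + 3 + (n + 1 + 1 - 1) = 3 * (n + 1 + 1) := by omega
    have e3 : 2 * (n + 1) + 4 + (n + 1 + 1 - 2) = 3 * (n + 1 + 1) := by omega
    rw [e1, e2, e3]
    rfl

theorem catTriangle_eq_binom {n k : ℕ} (hk : k < n) :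
    catTriangle n k = binom (n - 1 + k) k - binom (n - 1 + k) ((k : ℤ) - 1) := by
  obtain ⟨n, rfl⟩ : ∃ m, n = m + 1 := ⟨n - 1, by omega⟩
  rw [catTriangle_succ_eq_ballotNumber (by omega)]
  rfl

/-! ## Faces of an acyclic wiring -/

namespace PCPrograph

variable {n : ℕ}

/-- An arbitrary plugging of outputs into inputs; it shows that there are equally many. -/
def portEquiv (n : ℕ) : OutPort n ≃ InPort n where
  toFun
    | .source => .sink
    | .copLeft c => .prodLeft c
    | .copRight c => .prodRight c
    | .prodOut p => .copIn p
  invFun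
    | .sink => .source
    | .prodLeft p => .copLeft p
    | .prodRight p => .copRight p
    | .copIn c => .prodOut c
  left_inv x := by cases x <;> rfl
  right_inv x := by cases x <;> rfl

instance : Finite (OutPort n) := by
  let f : OutPort n → Option (Fin n ⊕ Fin n ⊕ Fin n)
    | .source => none
    | .copLeft c => some (.inl c)
    | .copRight c => some (.inr (.inl c))
    | .prodOut p => some (.inr (.inr p))
  refine Finite.of_injective f fun x y h => ?_
  cases x <;> cases y <;> simp_all [f]

instance : Finite (InPort n) := Finite.of_equiv _ (portEquiv n)

instance : Finite (Op n) := by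
  let f : Op n → Fin n ⊕ Fin n
    | .cop c => .inl c
    | .prod p => .inr p
  refine Finite.of_injective f fun x y h => ?_
  cases x <;> cases y <;> simp_all [f]

theorem OutPort.owner_eq_some {x : OutPort n} {v : Op n} : x.owner = some v ↔ x ∈ v.outputs := by
  cases x <;> cases v <;> simp [OutPort.owner, Op.outputs, eq_comm]

theorem OutPort.owner_eq_none {x : OutPort n} : x.owner = none ↔ x = .source := by
  cases x <;> simp [OutPort.owner]

theorem InPort.owner_eq_some {y : InPort n} {v : Op n} : y.owner = some v ↔ y ∈ v.inputs := by
  cases y <;> cases v <;> simp [InPort.owner, Op.inputs, eq_comm]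

variable {w : OutPort n ≃ InPort n}

theorem source_or_feeds {v : Op n} {y : InPort n} (hy : y ∈ v.inputs) :
    w.symm y = .source ∨ ∃ u, w.symm y ∈ u.outputs ∧ Feeds w u v := by
  rcases h : (w.symm y).owner with _ | u
  · exact .inl (OutPort.owner_eq_none.1 h)
  · have := OutPort.owner_eq_some.1 h
    exact .inr ⟨u, this, w.symm y, this, by simpa using hy⟩

theorem wellFounded_feeds (hw : ∀ v, ¬ Relation.TransGen (Feeds w) v v) :
    WellFounded (Feeds w) := by
  have : IsTrans (Op n) (Relation.TransGen (Feeds w)) := ⟨fun _ _ _ => Relation.TransGen.trans⟩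
  have : Std.Irrefl (Relation.TransGen (Feeds w)) := ⟨hw⟩
  exact Subrelation.wf (fun h => Relation.TransGen.single h)
    (Finite.wellFounded_of_trans_of_irrefl (Relation.TransGen (Feeds w)))

/-- Descending along inputs terminates, and it can only end at the operator that holds the global
input. Connectedness is thus automatic. -/
theorem preconnected_of_acyclic (hw : ∀ v, ¬ Relation.TransGen (Feeds w) v v) :
    (SimpleGraph.fromRel (Feeds w)).Preconnected := by
  have key : ∀ v, ∃ r, (w .source).owner = some r ∧
      (SimpleGraph.fromRel (Feeds w)).Reachable v r := by
    intro v
    induction v using (wellFounded_feeds hw).induction with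
    | _ v ih =>
      obtain ⟨y, hy⟩ : ∃ y, y ∈ v.inputs := by cases v <;> simp [Op.inputs]
      rcases source_or_feeds (w := w) hy with h | ⟨u, -, hu⟩
      · refine ⟨v, ?_, .rfl⟩
        rw [← h, Equiv.apply_symm_apply]
        exact InPort.owner_eq_some.2 hy
      · obtain ⟨r, hr, hur⟩ := ih u hu
        refine ⟨r, hr, .trans (SimpleGraph.Adj.reachable ?_) hur⟩
        rw [SimpleGraph.fromRel_adj]
        refine ⟨?_, .inr hu⟩
        rintro rfl
        exact hw _ (.single hu)
  intro u v
  obtain ⟨r, hr, hu⟩ := key u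
  obtain ⟨s, hs, hv⟩ := key v
  obtain rfl : r = s := by simpa [hr] using hs
  exact hu.trans hv.symm

/-! ### Faces as regions beside the wires -/

/-- The face of a half-edge. -/
def faceOf (w : OutPort n ≃ InPort n) (h : HalfEdge n) : Face w :=
  Quotient.mk (Equiv.Perm.SameCycle.setoid (rotation n * opposite w)) h

theorem faceOf_eq {g h : HalfEdge n} :
    faceOf w g = faceOf w h ↔ (rotation n * opposite w).SameCycle g h := Quotient.eq

theorem faceOf_next_inr (y : InPort n) :
    faceOf w (next (.inr y)) = faceOf w (.inl (w.symm y)) := by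
  rw [eq_comm, faceOf_eq]
  exact ⟨1, by simp [opposite, rotation]⟩

theorem faceOf_next_inl (x : OutPort n) :
    faceOf w (next (.inl x)) = faceOf w (.inr (w x)) := by
  rw [eq_comm, faceOf_eq]
  exact ⟨1, by simp [opposite, rotation]⟩

/-- The faces are named after the coproduct at the lowest point of the face; `inr false` and
`inr true` name the faces to the left and to the right of the prograph. -/
abbrev FaceName (n : ℕ) : Type := Fin n ⊕ Bool

/-- The face with a given name. -/
def nameFace (w : OutPort n ≃ InPort n) : FaceName n → Face w
  | .inl c => faceOf w (.inl (.copLeft c))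
  | .inr false => faceOf w (.inr .sink)
  | .inr true => faceOf w (.inl .source)

/-- `L x` and `R x` are admissible as colours of the regions to the left and to the right of the
wire that starts at `x`, as far as the passage from the inputs to the outputs of an operator is
concerned. -/
structure RegionColoring (w : OutPort n ≃ InPort n) {α : Type*} (name : FaceName n → α)
    (L R : OutPort n → α) : Prop where
  left_source : L .source = name (.inr false)
  right_source : R .source = name (.inr true)
  left_copLeft (c) : L (.copLeft c) = L (w.symm (.copIn c))
  right_copLeft (c) : R (.copLeft c) = name (.inl c)
  left_copRight (c) : L (.copRight c) = name (.inl c)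
  right_copRight (c) : R (.copRight c) = R (w.symm (.copIn c))
  left_prodOut (p) : L (.prodOut p) = L (w.symm (.prodLeft p))
  right_prodOut (p) : R (.prodOut p) = R (w.symm (.prodRight p))

/-- The colours agree between the two inputs of a product and at the global output. -/
structure ClosedColoring (w : OutPort n ≃ InPort n) {α : Type*} (name : FaceName n → α)
    (L R : OutPort n → α) : Prop extends RegionColoring w name L R where
  between (p) : R (w.symm (.prodLeft p)) = L (w.symm (.prodRight p))
  left_sink : L (w.symm .sink) = name (.inr false)
  right_sink : R (w.symm .sink) = name (.inr true)

/-- The half-edge at the start of a wire lies on the face to its right, the one at its end on the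
face to its left. Each equation that is not a definition is one step of the face permutation. -/
theorem closedColoring_faceOf (w : OutPort n ≃ InPort n) :
    ClosedColoring w (nameFace w) (fun x => faceOf w (.inr (w x))) (fun x => faceOf w (.inl x)) where
  left_source := (faceOf_next_inl _).symm
  right_source := rfl
  left_copLeft c := by
    rw [← faceOf_next_inl, Equiv.apply_symm_apply]
    rfl
  right_copLeft c := rfl
  left_copRight c := by
    rw [← faceOf_next_inl]
    rfl
  right_copRight c := by
    rw [← faceOf_next_inr]
    rfl
  left_prodOut p := by
    rw [← faceOf_next_inl, Equiv.apply_symm_apply]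
    rfl
  right_prodOut p := by
    rw [← faceOf_next_inr]
    rfl
  between p := by
    rw [← faceOf_next_inr, Equiv.apply_symm_apply]
    rfl
  left_sink := by
    rw [Equiv.apply_symm_apply]
    rfl
  right_sink := by
    rw [← faceOf_next_inr]
    rfl

/-- Induction from bottom to top: an operator passes on the regions beside its inputs, and the only
new region is the one between the outputs of a coproduct. -/
theorem nameFace_surjective (hw : ∀ v, ¬ Relation.TransGen (Feeds w) v v) :
    Function.Surjective (nameFace w) := by
  have C := closedColoring_faceOf w
  set L : OutPort n → Face w := fun x => faceOf w (.inr (w x)) with hL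
  set R : OutPort n → Face w := fun x => faceOf w (.inl x) with hR
  have key : ∀ v : Op n, ∀ x ∈ v.outputs,
      L x ∈ Set.range (nameFace w) ∧ R x ∈ Set.range (nameFace w) := by
    intro v
    induction v using (wellFounded_feeds hw).induction with
    | _ v ih =>
      have hin : ∀ y ∈ v.inputs, L (w.symm y) ∈ Set.range (nameFace w) ∧
          R (w.symm y) ∈ Set.range (nameFace w) := by
        intro y hy
        rcases source_or_feeds (w := w) hy with h | ⟨u, hu, huv⟩
        · rw [h]
          exact ⟨⟨_, C.left_source.symm⟩, ⟨_, C.right_source.symm⟩⟩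
        · exact ih u huv _ hu
      cases v with
      | cop c =>
        have := hin (.copIn c) (by simp [Op.inputs])
        simp only [Op.outputs, List.mem_cons, List.not_mem_nil, or_false, forall_eq_or_imp,
          forall_eq, C.left_copLeft, C.right_copLeft, C.left_copRight, C.right_copRight]
        exact ⟨⟨this.1, ⟨_, rfl⟩⟩, ⟨⟨_, rfl⟩, this.2⟩⟩
      | prod p =>
        have h1 := hin (.prodLeft p) (by simp [Op.inputs])
        have h2 := hin (.prodRight p) (by simp [Op.inputs])
        simp only [Op.outputs, List.mem_cons, List.not_mem_nil, or_false, forall_eq,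
          C.left_prodOut, C.right_prodOut]
        exact ⟨h1.1, h2.2⟩
  have key' : ∀ x, L x ∈ Set.range (nameFace w) ∧ R x ∈ Set.range (nameFace w) := by
    intro x
    rcases h : x.owner with _ | v
    · rw [OutPort.owner_eq_none.1 h]
      exact ⟨⟨_, C.left_source.symm⟩, ⟨_, C.right_source.symm⟩⟩
    · exact key v x (OutPort.owner_eq_some.1 h)
  intro f
  induction f using Quotient.inductionOn with
  | _ h =>
    rcases h with x | y
    · exact (key' x).2
    · have := (key' (w.symm y)).1
      simp only [hL, Equiv.apply_symm_apply] at this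
      exact this

instance : Finite (Face w) := inferInstanceAs (Finite (Quotient _))

theorem card_faceName (n : ℕ) : Nat.card (FaceName n) = n + 2 := by
  rw [Nat.card_eq_fintype_card]
  simp

/-- Euler's formula asks for exactly `n + 2` faces, as many as there are names. -/
theorem nameFace_injective (hw : ∀ v, ¬ Relation.TransGen (Feeds w) v v)
    (hF : (2 * n + 1) + Nat.card (Face w) = (3 * n + 1) + 2) :
    Function.Injective (nameFace w) := by
  refine ((nameFace_surjective hw).bijective_of_nat_card_le ?_).1
  rw [card_faceName]
  omega

/-- The colouring is constant on the cycles of the face permutation, so it descends to a left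
inverse of `nameFace`, and there are `n + 2` faces. -/
theorem ClosedColoring.planar {L R : OutPort n → FaceName n} (C : ClosedColoring w id L R)
    (hw : ∀ v, ¬ Relation.TransGen (Feeds w) v v) :
    (2 * n + 1) + Nat.card (Face w) = (3 * n + 1) + 2 := by
  let col : HalfEdge n → FaceName n
    | .inl x => R x
    | .inr y => L (w.symm y)
  have hcol : ∀ h, col ((rotation n * opposite w) h) = col h := by
    rintro (x | y)
    · obtain ⟨y, rfl⟩ := w.symm.surjective x
      cases y <;> simp [col, opposite, rotation, next, C.right_copRight, C.right_prodOut,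
        C.between, C.right_sink, C.right_source]
    · obtain ⟨x, rfl⟩ := w.surjective y
      cases x <;> simp [col, opposite, rotation, next, C.left_copRight, C.left_copLeft,
        C.left_prodOut, C.right_copLeft, C.left_sink, C.left_source]
  have hcyc : ∀ g h, (rotation n * opposite w).SameCycle g h → col g = col h := by
    intro g h hgh
    obtain ⟨i, rfl⟩ := hgh.exists_nat_pow_eq
    clear hgh
    induction i with
    | zero => rfl
    | succ i ih => rw [pow_succ', Equiv.Perm.mul_apply, hcol, ← ih]
  let colF : Face w → FaceName n := Quotient.lift col hcyc
  have h1 : Function.LeftInverse colF (nameFace w) := by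
    rintro (c | _ | _)
    · exact C.right_copLeft c
    · exact C.left_sink
    · exact C.right_source
  have := Nat.card_eq_of_bijective _ ⟨h1.injective, nameFace_surjective hw⟩
  rw [card_faceName] at this
  omega

end PCPrograph

/-! ## Canonical names of the operators -/

namespace PCPrograph

variable {n : ℕ}

/-- The position of an operator in the order: first the coproducts, then the products. -/
def Op.time : Op n → ℕ
  | .cop c => c
  | .prod p => n + p

/-- The operator at a given position, if there is one. -/
def opAt (n k : ℕ) : Option (Op n) :=
  if h : k < n then some (.cop ⟨k, h⟩)
  else if h : k - n < n then some (.prod ⟨k - n, h⟩) else none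

theorem Op.time_lt (v : Op n) : v.time < 2 * n := by
  cases v <;> simp only [Op.time] <;> omega

theorem opAt_eq_some {k : ℕ} {v : Op n} : opAt n k = some v ↔ v.time = k := by
  unfold opAt
  split_ifs with h1 h2
  · cases v <;> simp [Op.time, Fin.ext_iff] <;> omega
  · cases v <;> simp [Op.time, Fin.ext_iff] <;> omega
  · have := v.time_lt
    simp only [false_iff]
    omega

@[simp] theorem opAt_time (v : Op n) : opAt n v.time = some v := opAt_eq_some.2 rfl

theorem opAt_eq_none {k : ℕ} : opAt n k = none ↔ 2 * n ≤ k := by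
  unfold opAt
  split_ifs with h1 h2
  · simp; omega
  · simp; omega
  · simp; omega

theorem Op.time_injective : Function.Injective (Op.time (n := n)) := fun u v h => by
  have := opAt_time u
  rw [h, opAt_time] at this
  exact (Option.some.inj this).symm

theorem exists_time_eq {k : ℕ} (hk : k < 2 * n) : ∃ v : Op n, v.time = k := by
  rcases h : opAt n k with _ | v
  · have := opAt_eq_none.1 h
    omega
  · exact ⟨v, opAt_eq_some.1 h⟩

/-- All coproducts, then all products. -/
def canonicalOrder (n : ℕ) : List (Op n) :=
  (List.finRange n).map .cop ++ (List.finRange n).map .prod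

theorem length_canonicalOrder (n : ℕ) : (canonicalOrder n).length = 2 * n := by
  simp [canonicalOrder]
  omega

theorem getElem?_canonicalOrder (n k : ℕ) : (canonicalOrder n)[k]? = opAt n k := by
  unfold canonicalOrder opAt
  split_ifs with h1 h2
  · rw [List.getElem?_append_left (by simpa using h1)]
    simp [h1]
  · rw [List.getElem?_append_right (by simpa using h1)]
    simp [h2]
  · rw [List.getElem?_append_right (by simpa using h1)]
    simp at h2
    simp [h2]

theorem drop_canonicalOrder_time (v : Op n) :
    (canonicalOrder n).drop v.time = v :: (canonicalOrder n).drop (v.time + 1) := by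
  have h : v.time < (canonicalOrder n).length := by
    rw [length_canonicalOrder]
    exact v.time_lt
  rw [List.drop_eq_getElem_cons h]
  congr 1
  have := getElem?_canonicalOrder n v.time
  rw [opAt_time, List.getElem?_eq_getElem h] at this
  exact Option.some.inj this

/-! ### Renaming the operators -/

/-- Renaming as an equivalence. -/
noncomputable def OutPort.mapEquiv (σ τ : Equiv.Perm (Fin n)) : OutPort n ≃ OutPort n :=
  Equiv.ofBijective (OutPort.map σ τ) (Finite.injective_iff_bijective.1 OutPort.map_injective)

/-- Renaming as an equivalence. -/
noncomputable def InPort.mapEquiv (σ τ : Equiv.Perm (Fin n)) : InPort n ≃ InPort n :=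
  Equiv.ofBijective (InPort.map σ τ) (Finite.injective_iff_bijective.1 InPort.map_injective)

theorem Op.map_injective {σ τ : Equiv.Perm (Fin n)} : Function.Injective (Op.map σ τ) := by
  intro x y h
  cases x <;> cases y <;> simp_all [Op.map]

theorem Op.map_surjective {σ τ : Equiv.Perm (Fin n)} : Function.Surjective (Op.map σ τ) :=
  Finite.injective_iff_surjective.1 Op.map_injective

theorem next_map (σ τ : Equiv.Perm (Fin n)) (h : HalfEdge n) :
    next (Sum.map (OutPort.map σ τ) (InPort.map σ τ) h) =
      Sum.map (OutPort.map σ τ) (InPort.map σ τ) (next h) := by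
  rcases h with x | y
  · cases x <;> rfl
  · cases y <;> rfl

section Rename

variable {w w' : OutPort n ≃ InPort n} {σ τ : Equiv.Perm (Fin n)}

theorem feeds_map (h : ∀ x, w' (x.map σ τ) = (w x).map σ τ) (u v : Op n) :
    Feeds w' (u.map σ τ) (v.map σ τ) ↔ Feeds w u v := by
  simp only [Feeds, inputs_map, outputs_map, List.mem_map, exists_exists_and_eq_and, h,
    InPort.map_injective.eq_iff, exists_eq_right]

theorem acyclic_map (h : ∀ x, w' (x.map σ τ) = (w x).map σ τ)
    (hw : ∀ v, ¬ Relation.TransGen (Feeds w) v v) (v : Op n) :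
    ¬ Relation.TransGen (Feeds w') v v := by
  obtain ⟨v, rfl⟩ := Op.map_surjective (σ := σ) (τ := τ) v
  intro hv
  refine hw v ?_
  let r : Op n → Op n := Function.surjInv (Op.map_surjective (σ := σ) (τ := τ))
  have h1 : ∀ u, (r u).map σ τ = u := Function.surjInv_eq _
  have h2 : r (v.map σ τ) = v := Op.map_injective (h1 _)
  have h3 : Relation.TransGen (Feeds w) (r (v.map σ τ)) (r (v.map σ τ)) := by
    refine Relation.TransGen.lift (p := Feeds w) r (fun a b hab => ?_) _ _ hv
    change Feeds w (r a) (r b)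
    rwa [← feeds_map h, h1, h1]
  rwa [h2] at h3

/-- Renaming commutes with `next`, so the two face permutations are conjugate. -/
theorem card_face_map (h : ∀ x, w' (x.map σ τ) = (w x).map σ τ) :
    Nat.card (Face w') = Nat.card (Face w) := by
  let e : Equiv.Perm (HalfEdge n) := Equiv.sumCongr (OutPort.mapEquiv σ τ) (InPort.mapEquiv σ τ)
  have he : ∀ g, e g = Sum.map (OutPort.map σ τ) (InPort.map σ τ) g := fun g => rfl
  have h' : ∀ y, w'.symm (y.map σ τ) = (w.symm y).map σ τ := fun y => by
    rw [Equiv.symm_apply_eq, h, Equiv.apply_symm_apply]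
  have key : ∀ g, (rotation n * opposite w') (e g) = e ((rotation n * opposite w) g) := by
    intro g
    rw [he, he]
    refine Eq.trans ?_ (next_map σ τ _)
    change next _ = next _
    congr 1
    rcases g with x | y <;> simp [opposite, h, h']
  have conj : rotation n * opposite w' = e * (rotation n * opposite w) * e⁻¹ := by
    ext1 g
    obtain ⟨g, rfl⟩ := e.surjective g
    rw [key]
    simp
  refine Nat.card_congr (Quotient.congr e fun a b => ?_).symm
  change (rotation n * opposite w).SameCycle a b ↔ (rotation n * opposite w').SameCycle (e a) (e b)
  rw [conj, Equiv.Perm.sameCycle_conj]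
  simp

end Rename

/-- Renaming the operators of a prograph. -/
noncomputable def Named.rename (σ τ : Equiv.Perm (Fin n)) (G : Named n) : Named n :=
  let w' := (OutPort.mapEquiv σ τ).symm.trans (G.wire.trans (InPort.mapEquiv σ τ))
  have h : ∀ x, w' (x.map σ τ) = (G.wire x).map σ τ := fun x =>
    congrArg (InPort.mapEquiv σ τ) (congrArg G.wire ((OutPort.mapEquiv σ τ).symm_apply_apply x))
  { wire := w'
    connected := preconnected_of_acyclic (acyclic_map h G.acyclic)
    acyclic := acyclic_map h G.acyclic
    planar := by rw [card_face_map h]; exact G.planar }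

theorem Named.rename_wire (σ τ : Equiv.Perm (Fin n)) (G : Named n) (x : OutPort n) :
    (G.rename σ τ).wire (x.map σ τ) = (G.wire x).map σ τ :=
  congrArg (InPort.mapEquiv σ τ) (congrArg G.wire ((OutPort.mapEquiv σ τ).symm_apply_apply x))

theorem Named.length_labelFrom_le (G : Named n) (k : ℕ) (F : List (OutPort n)) :
    (G.labelFrom k F).length ≤ k := by
  induction k generalizing F with
  | zero => simp [labelFrom]
  | succ k ih =>
    rw [labelFrom]
    split
    · simp
    · simpa using ih _

theorem Named.CoproductsFirst.exists_canonical {G : Named n} (hG : G.CoproductsFirst) :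
    ∃ H, Iso G H ∧ H.labelling = canonicalOrder n := by
  obtain ⟨hc, hp⟩ := hG
  choose i hi hil using hc
  choose j hj hjl using hp
  simp only [Finset.mem_Icc] at hi hj
  -- Every operator is named by its own label; labels start at `1`, those of products at `n + 1`. A
  -- label determines its operator, so both maps are injective.
  let s : Fin n → Fin n := fun c => ⟨i c - 1, by have := hi c; omega⟩
  let t : Fin n → Fin n := fun p => ⟨j p - 1 - n, by have := hj p; omega⟩
  have hs : Function.Injective s := by
    intro c c' h
    have h1 : i c - 1 = i c' - 1 := congrArg Fin.val h
    have h2 := (hil c).2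
    rw [h1, (hil c').2] at h2
    simpa using h2.symm
  have ht : Function.Injective t := by
    intro p p' h
    have h1 : j p - 1 - n = j p' - 1 - n := congrArg Fin.val h
    have h0 : j p - 1 = j p' - 1 := by
      have := hj p
      have := hj p'
      omega
    have h2 := (hjl p).2
    rw [h0, (hjl p').2] at h2
    simpa using h2.symm
  let σ : Equiv.Perm (Fin n) := Equiv.ofBijective s (Finite.injective_iff_bijective.1 hs)
  let τ : Equiv.Perm (Fin n) := Equiv.ofBijective t (Finite.injective_iff_bijective.1 ht)
  refine ⟨G.rename σ τ, ⟨σ, τ, G.rename_wire σ τ⟩, ?_⟩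
  have hlab := labelling_map (G.rename_wire σ τ)
  have key : ∀ v : Op n, (G.rename σ τ).labelling[v.time]? = some v := by
    intro v
    obtain ⟨v, rfl⟩ := Op.map_surjective (σ := σ) (τ := τ) v
    rw [hlab, List.getElem?_map]
    suffices G.labelling[(v.map σ τ).time]? = some v by rw [this]; rfl
    cases v with
    | cop c => exact (hil c).2
    | prod p =>
      have : n + (j p - 1 - n) = j p - 1 := by
        have := hj p
        omega
      have h2 := (hjl p).2
      rw [← this] at h2
      exact h2
  refine List.ext_getElem? fun k => ?_
  rw [getElem?_canonicalOrder]
  by_cases hk : k < 2 * n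
  · obtain ⟨v, rfl⟩ := exists_time_eq hk
    rw [key, opAt_time]
  · rw [opAt_eq_none.2 (by omega), List.getElem?_eq_none]
    exact (Named.length_labelFrom_le _ _ _).trans (by omega)

theorem Named.coproductsFirst_of_canonical {G : Named n} (h : G.labelling = canonicalOrder n) :
    G.CoproductsFirst := by
  have key : ∀ v : Op n, G.HasLabel v (v.time + 1) := fun v =>
    ⟨by omega, by rw [Nat.add_sub_cancel, h, getElem?_canonicalOrder, opAt_time]⟩
  refine ⟨fun c => ⟨_, ?_, key (.cop c)⟩, fun p => ⟨_, ?_, key (.prod p)⟩⟩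
  · simp [Op.time]
  · simp [Op.time]
    omega

/-- The renaming carries the labelling to itself position by position, so it fixes every operator.
-/
theorem Named.eq_of_iso_of_canonical {G H : Named n} (h : Iso G H)
    (hG : G.labelling = canonicalOrder n) (hH : H.labelling = canonicalOrder n) : G = H := by
  obtain ⟨σ, τ, h⟩ := h
  have hl := labelling_map h
  rw [hG, hH] at hl
  have key : ∀ v : Op n, v.map σ τ = v := by
    intro v
    have := congrArg (fun l => l[v.time]?) hl
    simp only [List.getElem?_map, getElem?_canonicalOrder, opAt_time, Option.map_some] at this
    exact (Option.some.inj this).symm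
  have hσ : ∀ c, σ c = c := fun c => by simpa [Op.map] using key (.cop c)
  have hτ : ∀ p, τ p = p := fun p => by simpa [Op.map] using key (.prod p)
  refine Named.ext (Equiv.ext fun x => ?_)
  have h1 : x.map σ τ = x := by cases x <;> simp [OutPort.map, hσ, hτ]
  have h2 : ∀ y : InPort n, y.map σ τ = y := fun y => by cases y <;> simp [InPort.map, hσ, hτ]
  have := h x
  rw [h1, h2] at this
  exact this.symm

theorem card_coproductsFirst (n : ℕ) : Nat.card {P : PCPrograph n // P.CoproductsFirst} =
    Nat.card {G : Named n // G.labelling = canonicalOrder n} := by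
  symm
  refine Nat.card_eq_of_bijective
    (fun G => ⟨(Quotient.mk _ G.1 : PCPrograph n), Named.coproductsFirst_of_canonical G.2⟩) ⟨?_, ?_⟩
  · rintro ⟨G, hG⟩ ⟨H, hH⟩ h
    exact Subtype.ext (Named.eq_of_iso_of_canonical (Quotient.exact (congrArg Subtype.val h)) hG hH)
  · rintro ⟨P, hP⟩
    induction P using Quotient.inductionOn with
    | _ G =>
      obtain ⟨H, hGH, hH⟩ := Named.CoproductsFirst.exists_canonical hP
      exact ⟨⟨H, hH⟩, Subtype.ext (Quotient.sound hGH).symm⟩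

end PCPrograph

/-! ## Codes of prographs whose coproducts come first -/

namespace PCPrograph

variable {n : ℕ} {f : ℕ → ℕ} {g : InPort n → OutPort n}

/-- The open wires after `k` steps if the operator of time `i` is plugged into consecutive open
wires, from position `f i` on. -/
def codeFrontier (n : ℕ) (f : ℕ → ℕ) : ℕ → List (OutPort n)
  | 0 => [.source]
  | k + 1 =>
    match opAt n k with
    | some v => (codeFrontier n f k).take (f k) ++ v.outputs ++
        (codeFrontier n f k).drop (f k + v.inputs.length)
    | none => codeFrontier n f k

theorem codeFrontier_succ (v : Op n) : codeFrontier n f (v.time + 1) =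
    (codeFrontier n f v.time).take (f v.time) ++ v.outputs ++
      (codeFrontier n f v.time).drop (f v.time + v.inputs.length) := by
  simp [codeFrontier]

/-- The number of operators up to and including the one that a wire leaves. -/
def OutPort.birth (x : OutPort n) : ℕ := x.owner.elim 0 (fun v => v.time + 1)

theorem OutPort.birth_eq {x : OutPort n} {v : Op n} : x.birth = v.time + 1 ↔ x ∈ v.outputs := by
  rw [← OutPort.owner_eq_some, OutPort.birth]
  rcases x.owner with _ | u
  · simp
  · simp [Op.time_injective.eq_iff]

theorem birth_le_of_mem_codeFrontier {k : ℕ} {x : OutPort n} (hx : x ∈ codeFrontier n f k) :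
    x.birth ≤ k := by
  induction k with
  | zero =>
    simp only [codeFrontier, List.mem_singleton] at hx
    subst hx
    simp [OutPort.birth, OutPort.owner]
  | succ k ih =>
    rcases h : opAt n k with _ | v
    · simp only [codeFrontier, h] at hx
      exact (ih hx).trans (by omega)
    · obtain rfl := opAt_eq_some.1 h
      rw [codeFrontier_succ, List.mem_append, List.mem_append] at hx
      rcases hx with (hx | hx) | hx
      · exact (ih (List.mem_of_mem_take hx)).trans (by omega)
      · exact (OutPort.birth_eq.2 hx).le
      · exact (ih (List.mem_of_mem_drop hx)).trans (by omega)

/-- A step adds only wires born at that step, so a wire that is open now has been open since its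
birth. -/
theorem mem_codeFrontier_of_le {k m : ℕ} {x : OutPort n} (hx : x ∈ codeFrontier n f m)
    (hk : x.birth ≤ k) (hkm : k ≤ m) : x ∈ codeFrontier n f k := by
  induction m, hkm using Nat.le_induction with
  | base => exact hx
  | succ m hkm ih =>
    apply ih
    rcases h : opAt n m with _ | v
    · simpa only [codeFrontier, h] using hx
    · obtain rfl := opAt_eq_some.1 h
      rw [codeFrontier_succ, List.mem_append, List.mem_append] at hx
      rcases hx with (hx | hx) | hx
      · exact List.mem_of_mem_take hx
      · have := OutPort.birth_eq.2 hx
        omega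
      · exact List.mem_of_mem_drop hx

theorem Op.nodup_outputs (v : Op n) : v.outputs.Nodup := by
  cases v <;> simp [Op.outputs]

theorem nodup_codeFrontier (k : ℕ) : (codeFrontier n f k).Nodup := by
  induction k with
  | zero => simp [codeFrontier]
  | succ k ih =>
    rcases h : opAt n k with _ | v
    · simpa only [codeFrontier, h] using ih
    · obtain rfl := opAt_eq_some.1 h
      rw [codeFrontier_succ]
      have hnew : ∀ x ∈ v.outputs, x ∉ codeFrontier n f v.time := by
        intro x hx hx'
        have := birth_le_of_mem_codeFrontier hx'
        have := OutPort.birth_eq.2 hx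
        omega
      have hsub : ((codeFrontier n f v.time).take (f v.time) ++
          (codeFrontier n f v.time).drop (f v.time + v.inputs.length)).Nodup := by
        refine ih.sublist ?_
        conv_rhs => rw [← List.take_append_drop (f v.time) (codeFrontier n f v.time)]
        refine (List.Sublist.refl _).append ?_
        rw [← List.drop_drop]
        exact List.drop_sublist _ _
      rw [List.append_assoc, List.nodup_append'] at *
      rw [List.nodup_append']
      refine ⟨hsub.1, ⟨v.nodup_outputs, hsub.2.1, ?_⟩, ?_⟩
      · exact fun x hx hx' => hnew x hx (List.mem_of_mem_drop hx')
      · intro x hx hx'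
        rcases List.mem_append.1 hx' with hx' | hx'
        · exact hnew x hx' (List.mem_of_mem_take hx)
        · exact hsub.2.2 hx hx'

theorem codeFrontier_succ_of_eq {v : Op n} {A X B : List (OutPort n)}
    (h : codeFrontier n f v.time = A ++ X ++ B) (hA : A.length = f v.time)
    (hX : X.length = v.inputs.length) :
    codeFrontier n f (v.time + 1) = A ++ v.outputs ++ B := by
  rw [codeFrontier_succ, h, ← hA, ← hX, ← List.length_append, List.drop_left,
    List.append_assoc A X B, List.take_left]

/-- The number of open wires after `k` steps. -/
def frontierLength (n k : ℕ) : ℕ := if k ≤ n then k + 1 else 2 * n + 1 - k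

theorem frontierLength_cop (c : Fin n) : frontierLength n (Op.cop c).time = c + 1 := by
  rw [frontierLength, if_pos (by simp only [Op.time]; omega)]
  rfl

theorem frontierLength_prod (p : Fin n) : frontierLength n (Op.prod p).time = n + 1 - p := by
  change frontierLength n (n + p) = _
  by_cases h : n + (p : ℕ) ≤ n
  · rw [frontierLength, if_pos h]
    omega
  · rw [frontierLength, if_neg h]
    omega

/-- The alternative serves both directions: a code bounds its positions by `frontierLength`, the
code of a prograph by the actual list. The induction shows that the two lengths agree. -/
theorem length_codeFrontier
    (h : ∀ v : Op n, f v.time + v.inputs.length ≤ frontierLength n v.time ∨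
      f v.time + v.inputs.length ≤ (codeFrontier n f v.time).length) {k : ℕ} (hk : k ≤ 2 * n) :
    (codeFrontier n f k).length = frontierLength n k := by
  induction k with
  | zero => simp [codeFrontier, frontierLength]
  | succ k ih =>
    obtain ⟨v, rfl⟩ := exists_time_eq hk
    have ih := ih (by omega)
    have hv := h v
    rw [codeFrontier_succ]
    simp only [List.length_append, List.length_take, List.length_drop]
    rw [ih] at hv ⊢
    rcases v with c | p
    · have := c.isLt
      rw [frontierLength_cop] at hv ⊢
      have e : frontierLength n ((Op.cop c).time + 1) = c + 2 := by
        rw [frontierLength, if_pos (by simp only [Op.time]; omega)]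
        rfl
      simp only [e, Op.inputs, Op.outputs, List.length_cons, List.length_nil] at hv ⊢
      omega
    · have := p.isLt
      rw [frontierLength_prod] at hv ⊢
      have e : frontierLength n ((Op.prod p).time + 1) = n - p := by
        rw [frontierLength, if_neg (by simp only [Op.time]; omega)]
        simp only [Op.time]
        omega
      simp only [e, Op.inputs, Op.outputs, List.length_cons, List.length_nil] at hv ⊢
      omega

/-! ### Codes and wirings determine each other -/

/-- If `g` tells where the wires to the inputs start, then the inputs of the operator of time `i`
are consecutive open wires, from position `f i` on. -/
def Splits (g : InPort n → OutPort n) (f : ℕ → ℕ) : Prop :=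
  ∀ v : Op n, ∃ A B, codeFrontier n f v.time = A ++ v.inputs.map g ++ B ∧ A.length = f v.time

/-- `f` is the code of the wiring `g`. -/
structure Realizes (g : InPort n → OutPort n) (f : ℕ → ℕ) : Prop where
  splits : Splits g f
  sink : codeFrontier n f (2 * n) = [g .sink]

theorem Splits.mem (h : Splits g f) {v : Op n} {y : InPort n} (hy : y ∈ v.inputs) :
    g y ∈ codeFrontier n f v.time := by
  obtain ⟨A, B, hAB, -⟩ := h v
  rw [hAB]
  simp only [List.mem_append, List.mem_map]
  exact .inl (.inr ⟨y, hy, rfl⟩)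

theorem Splits.birth_le (h : Splits g f) {v : Op n} {y : InPort n} (hy : y ∈ v.inputs) :
    (g y).birth ≤ v.time := birth_le_of_mem_codeFrontier (h.mem hy)

/-- If the wire were open later, it would be open directly after `v`. There it is not among the old
wires, which are listed without repetition, nor among the outputs of `v`, which are born too late.
-/
theorem Splits.notMem (h : Splits g f) {v : Op n} {y : InPort n} (hy : y ∈ v.inputs) {m : ℕ}
    (hm : v.time < m) : g y ∉ codeFrontier n f m := by
  intro hmem
  have hb := h.birth_le hy
  have h1 := mem_codeFrontier_of_le hmem (hb.trans (Nat.le_succ _)) hm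
  obtain ⟨A, B, hAB, hA⟩ := h v
  have hnd := nodup_codeFrontier (n := n) (f := f) v.time
  rw [Nat.succ_eq_add_one, codeFrontier_succ_of_eq hAB hA (by simp)] at h1
  rw [hAB, List.nodup_append', List.nodup_append', List.disjoint_append_left] at hnd
  have hy' : g y ∈ v.inputs.map g := List.mem_map_of_mem hy
  rcases List.mem_append.1 h1 with h1 | h1
  · rcases List.mem_append.1 h1 with h1 | h1
    · exact hnd.1.2.2 h1 hy'
    · have := OutPort.birth_eq.2 h1
      omega
  · exact hnd.2.2.2 hy' h1

/-- A wire is used up by the first operator that takes it, the inputs of one operator are distinct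
open wires, and the wire to the global output is never used up. -/
theorem Realizes.injective (h : Realizes g f) : Function.Injective g := by
  have hsink : ∀ (v : Op n) (y) (_ : y ∈ v.inputs), g y ≠ g .sink := by
    intro v y hy heq
    refine h.splits.notMem hy v.time_lt ?_
    rw [h.sink, heq]
    simp
  intro y y' hyy
  rcases hy : y.owner with _ | v <;> rcases hy' : y'.owner with _ | v'
  · cases y <;> cases y' <;> simp_all [InPort.owner]
  · rw [InPort.owner_eq_some] at hy'
    obtain rfl : y = .sink := by cases y <;> simp_all [InPort.owner]
    exact absurd hyy.symm (hsink _ _ hy')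
  · rw [InPort.owner_eq_some] at hy
    obtain rfl : y' = .sink := by cases y' <;> simp_all [InPort.owner]
    exact absurd hyy (hsink _ _ hy)
  · rw [InPort.owner_eq_some] at hy hy'
    rcases lt_trichotomy v.time v'.time with hlt | heq | hlt
    · exact absurd (hyy ▸ h.splits.mem hy') (h.splits.notMem hy hlt)
    · obtain rfl := Op.time_injective heq
      obtain ⟨A, B, hAB, -⟩ := h.splits v
      have hnd := nodup_codeFrontier (n := n) (f := f) v.time
      rw [hAB, List.nodup_append', List.nodup_append'] at hnd
      exact List.inj_on_of_nodup_map hnd.1.2.1 hy hy' hyy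
    · exact absurd (hyy ▸ h.splits.mem hy) (h.splits.notMem hy' hlt)

theorem Realizes.unique {g' : InPort n → OutPort n} (h : Realizes g f) (h' : Realizes g' f) :
    g = g' := by
  funext y
  rcases hy : y.owner with _ | v
  · obtain rfl : y = .sink := by cases y <;> simp_all [InPort.owner]
    simpa using h.sink.symm.trans h'.sink
  · rw [InPort.owner_eq_some] at hy
    obtain ⟨A, B, hAB, hA⟩ := h.splits v
    obtain ⟨A', B', hAB', hA'⟩ := h'.splits v
    have h1 := hAB.symm.trans hAB'
    rw [List.append_assoc, List.append_assoc] at h1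
    have h2 := (List.append_inj h1 (hA.trans hA'.symm)).2
    have h3 := (List.append_inj h2 (by simp)).1
    exact List.map_inj_left.1 h3 y hy

theorem idxOf_of_eq_append {l A B : List (OutPort n)} {x : OutPort n} (hl : l.Nodup)
    (h : l = A ++ x :: B) : l.idxOf x = A.length := by
  subst h
  rw [List.idxOf_append_of_notMem]
  · simp
  · rw [List.nodup_append'] at hl
    exact fun hx => hl.2.2 hx (by simp)

theorem Op.inputs_ne_nil (v : Op n) : ∃ y l, v.inputs = y :: l := by
  cases v <;> simp [Op.inputs]

theorem Splits.code_unique {f' : ℕ → ℕ} (h : Splits g f) (h' : Splits g f') {k : ℕ}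
    (hk : k < 2 * n) : f k = f' k := by
  have key : ∀ v : Op n, codeFrontier n f v.time = codeFrontier n f' v.time →
      f v.time = f' v.time := by
    intro v hv
    obtain ⟨A, B, hAB, hA⟩ := h v
    obtain ⟨A', B', hAB', hA'⟩ := h' v
    obtain ⟨y, l, hy⟩ := v.inputs_ne_nil
    rw [hy, List.map_cons, List.append_assoc, List.cons_append] at hAB hAB'
    rw [← hA, ← hA', ← idxOf_of_eq_append (nodup_codeFrontier _) hAB,
      ← idxOf_of_eq_append (nodup_codeFrontier _) hAB', hv]
  have hfr : ∀ k ≤ 2 * n, codeFrontier n f k = codeFrontier n f' k := by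
    intro k hk
    induction k with
    | zero => rfl
    | succ k ih =>
      obtain ⟨v, rfl⟩ := exists_time_eq hk
      rw [codeFrontier_succ, codeFrontier_succ, ih (by omega), key v (ih (by omega))]
  obtain ⟨v, rfl⟩ := exists_time_eq hk
  exact key v (hfr _ hk.le)

/-- The codes of the prographs whose coproducts come first. -/
structure IsCode (n : ℕ) (f : ℕ → ℕ) : Prop where
  zero : ∀ k, 2 * n ≤ k → f k = 0
  fits : ∀ v : Op n, f v.time + v.inputs.length ≤ frontierLength n v.time
  step : ∀ u v : Op n, u.time = v.time + 1 → f v.time < f u.time + u.inputs.length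

theorem IsCode.exists_realizes (hf : IsCode n f) :
    ∃ w : OutPort n ≃ InPort n, Realizes w.symm f := by
  have hlen : ∀ k ≤ 2 * n, (codeFrontier n f k).length = frontierLength n k := fun k hk =>
    length_codeFrontier (fun v => .inl (hf.fits v)) hk
  -- The default `.source` is never reached, since `fits` keeps all positions inside the list.
  let g : InPort n → OutPort n
    | .sink => (codeFrontier n f (2 * n)).getD 0 .source
    | .copIn c => (codeFrontier n f c).getD (f c) .source
    | .prodLeft p => (codeFrontier n f (n + p)).getD (f (n + p)) .source
    | .prodRight p => (codeFrontier n f (n + p)).getD (f (n + p) + 1) .source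
  have hg : Realizes g f := by
    constructor
    · intro v
      have hv := hf.fits v
      rw [← hlen _ v.time_lt.le] at hv
      refine ⟨(codeFrontier n f v.time).take (f v.time),
        (codeFrontier n f v.time).drop (f v.time + v.inputs.length), ?_, ?_⟩
      · conv_lhs => rw [← List.take_append_drop (f v.time) (codeFrontier n f v.time)]
        rw [List.append_assoc]
        congr 1
        cases v with
        | cop c =>
          simp only [Op.inputs, Op.time, List.length_cons, List.length_nil, g, List.map_cons,
            List.map_nil] at hv ⊢
          rw [List.drop_eq_getElem_cons (by omega), List.getD_eq_getElem _ _ (by omega)]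
          rfl
        | prod p =>
          simp only [Op.inputs, Op.time, List.length_cons, List.length_nil, g, List.map_cons,
            List.map_nil] at hv ⊢
          rw [List.drop_eq_getElem_cons (by omega), List.drop_eq_getElem_cons (by omega),
            List.getD_eq_getElem _ _ (by omega), List.getD_eq_getElem _ _ (by omega)]
          rfl
      · rw [List.length_take]
        omega
    · have h1 := hlen (2 * n) le_rfl
      have h2 : frontierLength n (2 * n) = 1 := by
        unfold frontierLength
        split_ifs <;> omega
      rw [h2, List.length_eq_one_iff] at h1
      obtain ⟨x, hx⟩ := h1
      simp [g, hx]
  have hbij : Function.Bijective g := by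
    have h1 : Function.Injective (g ∘ portEquiv n) := hg.injective.comp (portEquiv n).injective
    have h2 := Finite.injective_iff_bijective.1 h1
    exact (Function.Bijective.of_comp_iff g (portEquiv n).bijective).1 h2
  exact ⟨(Equiv.ofBijective g hbij).symm, hg⟩

/-! ### Regions along the open wires -/

section Linked

variable {α : Type*} {L R : OutPort n → α} {w : OutPort n ≃ InPort n} {name : FaceName n → α}

/-- The regions between consecutive open wires agree; `a` is to the left of the first one, `b` is
to the right of the last one. -/
def Linked (L R : OutPort n → α) : α → List (OutPort n) → α → Prop
  | a, [], b => a = b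
  | a, x :: F, b => L x = a ∧ Linked L R (R x) F b

theorem linked_append {a b : α} {A B : List (OutPort n)} :
    Linked L R a (A ++ B) b ↔ ∃ c, Linked L R a A c ∧ Linked L R c B b := by
  induction A generalizing a with
  | nil => simp [Linked]
  | cons x A ih => simp [Linked, ih, and_assoc]

theorem RegionColoring.linked_outputs (C : RegionColoring w name L R) {v : Op n} {a b : α}
    (h : Linked L R a (v.inputs.map w.symm) b) : Linked L R a v.outputs b := by
  cases v with
  | cop c =>
    simp only [Op.inputs, Op.outputs, List.map_cons, List.map_nil, Linked] at h ⊢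
    rw [C.left_copLeft, C.right_copLeft, C.left_copRight, C.right_copRight]
    exact ⟨h.1, rfl, h.2⟩
  | prod p =>
    simp only [Op.inputs, Op.outputs, List.map_cons, List.map_nil, Linked] at h ⊢
    rw [C.left_prodOut, C.right_prodOut]
    exact ⟨h.1, h.2.2⟩

theorem RegionColoring.linked_succ (C : RegionColoring w name L R) {v : Op n} {a b : α}
    {A B : List (OutPort n)} (h : Linked L R a (A ++ v.inputs.map w.symm ++ B) b) :
    Linked L R a (A ++ v.outputs ++ B) b := by
  rw [linked_append] at h ⊢
  obtain ⟨d, h1, h2⟩ := h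
  rw [linked_append] at h1
  obtain ⟨c, h0, h1⟩ := h1
  exact ⟨d, linked_append.2 ⟨c, h0, C.linked_outputs h1⟩, h2⟩

/-- When the inputs are consecutive, an operator replaces a block of wires without changing the
regions at the two ends of the block. -/
theorem RegionColoring.linked (C : RegionColoring w name L R) (h : Splits w.symm f) {k : ℕ}
    (hk : k ≤ 2 * n) :
    Linked L R (name (.inr false)) (codeFrontier n f k) (name (.inr true)) := by
  induction k with
  | zero => exact ⟨C.left_source, C.right_source⟩
  | succ k ih =>
    obtain ⟨v, rfl⟩ := exists_time_eq hk
    obtain ⟨A, B, hAB, hA⟩ := h v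
    have ih := ih (by omega)
    rw [hAB] at ih
    rw [codeFrontier_succ_of_eq hAB hA (by simp)]
    exact C.linked_succ ih

/-- The inputs of a product are neighbours among the open wires, and the last open wire is the
global output with both outer regions beside it. -/
theorem RegionColoring.closed (C : RegionColoring w name L R) (h : Realizes w.symm f) :
    ClosedColoring w name L R := by
  refine ⟨C, fun p => ?_, ?_, ?_⟩
  · obtain ⟨A, B, hAB, -⟩ := h.splits (.prod p)
    have h1 := C.linked h.splits (Op.time_lt (.prod p)).le
    rw [hAB, linked_append] at h1
    obtain ⟨d, h1, -⟩ := h1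
    rw [linked_append] at h1
    obtain ⟨c, -, h1⟩ := h1
    exact h1.2.1.symm
  all_goals
    have h1 := C.linked h.splits le_rfl
    rw [h.sink] at h1
  · exact h1.1
  · exact h1.2

/-- Two open wires with a common region between them are consecutive. -/
theorem Linked.exists_append {a b : α} {F : List (OutPort n)} (h : Linked L R a F b)
    (hnd : (a :: F.map R).Nodup) {x y : OutPort n} (hx : x ∈ F) (hy : y ∈ F) (hxy : R x = L y) :
    ∃ A B, F = A ++ [x, y] ++ B := by
  obtain ⟨A, B, rfl⟩ := List.append_of_mem hy
  rcases List.eq_nil_or_concat A with rfl | ⟨A, z, rfl⟩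
  · have h1 : R x = a := hxy.trans h.1
    rw [List.nodup_cons] at hnd
    exact absurd (h1 ▸ List.mem_map_of_mem hx) hnd.1
  · rw [linked_append] at h
    obtain ⟨c, h1, h2⟩ := h
    rw [List.concat_eq_append, linked_append] at h1
    obtain ⟨d, -, h1⟩ := h1
    have h3 : R x = R z := hxy.trans (h2.1.trans h1.2.symm)
    have : x = z := List.inj_on_of_nodup_map (List.nodup_cons.1 hnd).2 hx (by simp) h3
    exact ⟨A, B, by simp [this]⟩

end Linked

/-- The colour of the region to the left of a wire, computed downwards. -/
def leftColor (g : InPort n → OutPort n) (hg : ∀ v : Op n, ∀ y ∈ v.inputs, (g y).birth ≤ v.time) :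
    OutPort n → FaceName n
  | .source => .inr false
  | .copLeft c => leftColor g hg (g (.copIn c))
  | .copRight c => .inl c
  | .prodOut p => leftColor g hg (g (.prodLeft p))
termination_by x => x.birth
decreasing_by
  · exact Nat.lt_succ_of_le (hg (.cop c) _ (by simp [Op.inputs]))
  · exact Nat.lt_succ_of_le (hg (.prod p) _ (by simp [Op.inputs]))

/-- The colour of the region to the right of a wire, computed downwards. -/
def rightColor (g : InPort n → OutPort n) (hg : ∀ v : Op n, ∀ y ∈ v.inputs, (g y).birth ≤ v.time) :
    OutPort n → FaceName n
  | .source => .inr true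
  | .copLeft c => .inl c
  | .copRight c => rightColor g hg (g (.copIn c))
  | .prodOut p => rightColor g hg (g (.prodRight p))
termination_by x => x.birth
decreasing_by
  · exact Nat.lt_succ_of_le (hg (.cop c) _ (by simp [Op.inputs]))
  · exact Nat.lt_succ_of_le (hg (.prod p) _ (by simp [Op.inputs]))

theorem regionColoring_color {w : OutPort n ≃ InPort n}
    (hg : ∀ v : Op n, ∀ y ∈ v.inputs, (w.symm y).birth ≤ v.time) :
    RegionColoring w id (leftColor w.symm hg) (rightColor w.symm hg) := by
  constructor <;> intros <;> first | rw [leftColor]; rfl | rw [rightColor]; rfl | skip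
  all_goals first | rw [leftColor] | rw [rightColor]

theorem Realizes.acyclic {w : OutPort n ≃ InPort n} (h : Realizes w.symm f) (v : Op n) :
    ¬ Relation.TransGen (Feeds w) v v := by
  have h1 : ∀ u v, Feeds w u v → u.time < v.time := by
    rintro u v ⟨x, hx, hxv⟩
    have h2 := h.splits.birth_le hxv
    rw [Equiv.symm_apply_apply, OutPort.birth_eq.2 hx] at h2
    omega
  intro hv
  have h2 : ∀ u, Relation.TransGen (Feeds w) v u → v.time < u.time := by
    intro u hu
    induction hu with
    | single hu => exact h1 _ _ hu
    | tail _ hu ih => exact ih.trans (h1 _ _ hu)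
  exact lt_irrefl _ (h2 v hv)

/-- The prograph with a given code. -/
def Realizes.toNamed {w : OutPort n ≃ InPort n} (h : Realizes w.symm f) : Named n where
  wire := w
  connected := preconnected_of_acyclic h.acyclic
  acyclic := h.acyclic
  planar := ((regionColoring_color fun _ _ hy => h.splits.birth_le hy).closed h).planar h.acyclic

end PCPrograph

/-! ### The labelling of a prograph with a given code -/

namespace PCPrograph

variable {n : ℕ} {f : ℕ → ℕ} {g : InPort n → OutPort n}

theorem notMem_of_nodup_append {α : Type*} {A X B : List α} (h : (A ++ X ++ B).Nodup) {x : α}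
    (hx : x ∈ X) : x ∉ A ∧ x ∉ B := by
  rw [List.nodup_append', List.nodup_append', List.disjoint_append_left] at h
  exact ⟨fun hA => h.1.2.2 hA hx, fun hB => h.2.2.2 hx hB⟩

theorem prefix_of_append_eq {α : Type*} {A X B A' X' B' : List α}
    (h : A ++ X ++ B = A' ++ X' ++ B') (hle : A.length ≤ A'.length) : A <+: A' := by
  have h1 : A <+: A' ++ X' ++ B' := by
    rw [← h, List.append_assoc]
    exact List.prefix_append _ _
  have h2 : A' <+: A' ++ X' ++ B' := by
    rw [List.append_assoc]
    exact List.prefix_append _ _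
  exact List.prefix_of_prefix_length_le h1 h2 hle

namespace Named

variable {G : Named n} {F A B : List (OutPort n)} {v : Op n}

theorem advance_eq (hF : F.Nodup) (h : F = A ++ v.inputs.map G.wire.symm ++ B) :
    G.advance F v = A ++ v.outputs ++ B := by
  have hout : ∀ x, G.wire x ∉ v.inputs →
      (if v.inputs.head? = some (G.wire x) then v.outputs
        else if G.wire x ∈ v.inputs then [] else [x]) = [x] := by
    intro x hx
    rw [if_neg fun h => hx (List.mem_of_head? h), if_neg hx]
  subst h
  have hmem : ∀ x, G.wire x ∈ v.inputs → x ∈ v.inputs.map G.wire.symm := fun x hx =>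
    List.mem_map.2 ⟨_, hx, by simp⟩
  have hid : ∀ l : List (OutPort n), (∀ x ∈ l, G.wire x ∉ v.inputs) →
      l.flatMap (fun x => if v.inputs.head? = some (G.wire x) then v.outputs
        else if G.wire x ∈ v.inputs then [] else [x]) = l := by
    intro l hl
    induction l with
    | nil => rfl
    | cons x l ih =>
      rw [List.flatMap_cons, hout x (hl x (by simp)), ih fun y hy => hl y (by simp [hy])]
      rfl
  rw [advance, List.flatMap_append, List.flatMap_append,
    hid A fun x hx hxv => (notMem_of_nodup_append hF (hmem x hxv)).1 hx,
    hid B fun x hx hxv => (notMem_of_nodup_append hF (hmem x hxv)).2 hx]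
  congr 2
  cases v <;> simp [Op.inputs, Op.outputs]

theorem ready_of_eq (h : F = A ++ v.inputs.map G.wire.symm ++ B) : G.Ready F v := by
  intro y hy
  rw [h]
  simp only [List.mem_append, List.mem_map]
  exact .inl (.inr ⟨y, hy, rfl⟩)

/-- The search passes over `A`, where no wire leads to a ready operator, and then meets the first
input of `v`. -/
theorem leftmostReady_eq_some (h : F = A ++ v.inputs.map G.wire.symm ++ B)
    (hA : ∀ u, G.Ready F u → ∀ y ∈ u.inputs, G.wire.symm y ∉ A) :
    G.leftmostReady F = some v := by
  have h1 : (A.filterMap fun x => (G.wire x).owner).find? (fun v => decide (G.Ready F v)) =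
      none := by
    rw [List.find?_eq_none]
    intro u hu hr
    obtain ⟨x, hx, hxu⟩ := List.mem_filterMap.1 hu
    exact hA u (of_decide_eq_true hr) _ (InPort.owner_eq_some.1 hxu) (by simpa using hx)
  have h2 : F.filterMap (fun x => (G.wire x).owner) = A.filterMap (fun x => (G.wire x).owner) ++
      ((v.inputs.map G.wire.symm).filterMap (fun x => (G.wire x).owner) ++
        B.filterMap (fun x => (G.wire x).owner)) := by
    rw [h, List.filterMap_append, List.filterMap_append, List.append_assoc]
  obtain ⟨y, l, hy⟩ := v.inputs_ne_nil
  have h3 : y.owner = some v := InPort.owner_eq_some.2 (by simp [hy])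
  rw [leftmostReady, h2, List.find?_append, h1, hy, List.map_cons, List.filterMap_cons_some
    (b := v) (by simpa using h3), List.cons_append, List.find?_cons_of_pos
    (by simpa using ready_of_eq h)]
  rfl

theorem ready_of_leftmostReady (h : G.leftmostReady F = some v) : G.Ready F v := by
  simpa using List.find?_some h

/-- An operator with all inputs in `A` would be ready, and the search would end within `A`, which
contains no input of `v`. -/
theorem not_subset_of_leftmostReady (hF : F.Nodup) (h : F = A ++ v.inputs.map G.wire.symm ++ B)
    (hv : G.leftmostReady F = some v) (u : Op n) : ¬ ∀ y ∈ u.inputs, G.wire.symm y ∈ A := by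
  intro hu
  obtain ⟨y, l, hy⟩ := u.inputs_ne_nil
  have hyu : y ∈ u.inputs := by simp [hy]
  have h1 : u ∈ A.filterMap fun x => (G.wire x).owner :=
    List.mem_filterMap.2 ⟨_, hu y hyu, by simpa using InPort.owner_eq_some.2 hyu⟩
  have hr : G.Ready F u := fun z hz => by simp [h, hu z hz]
  have h2 : F.filterMap (fun x => (G.wire x).owner) = A.filterMap (fun x => (G.wire x).owner) ++
      (v.inputs.map G.wire.symm ++ B).filterMap (fun x => (G.wire x).owner) := by
    rw [h, List.append_assoc, List.filterMap_append]
  rw [leftmostReady, h2, List.find?_append] at hv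
  rcases h3 : (A.filterMap fun x => (G.wire x).owner).find? (fun v => decide (G.Ready F v))
    with _ | v'
  · exact List.find?_eq_none.1 h3 u h1 (by simpa using hr)
  · rw [h3, Option.some_or, Option.some.injEq] at hv
    subst hv
    obtain ⟨x, hx, hxv⟩ := List.mem_filterMap.1 (List.mem_of_find?_eq_some h3)
    rw [h] at hF
    exact (notMem_of_nodup_append hF (List.mem_map.2 ⟨_, InPort.owner_eq_some.1 hxv,
      G.wire.symm_apply_apply x⟩)).1 hx

end Named

/-- In a wiring with a code, no operator that comes later uses an open wire to the left of the
wires that are used next, if it is ready. -/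
theorem Splits.notMem_left (h : Splits g f)
    (hf : ∀ u v : Op n, u.time = v.time + 1 → f v.time < f u.time + u.inputs.length)
    {u v : Op n} (huv : v.time < u.time) {A B : List (OutPort n)}
    (hv : codeFrontier n f v.time = A ++ v.inputs.map g ++ B) (hA : A.length = f v.time)
    (hu : ∀ y ∈ u.inputs, g y ∈ codeFrontier n f v.time) : ∀ y ∈ u.inputs, g y ∉ A := by
  obtain ⟨d, hd⟩ := Nat.exists_eq_add_of_lt huv
  induction d generalizing v A B with
  | zero =>
    obtain ⟨A', B', hAB', hA'⟩ := h u
    have hnd := nodup_codeFrontier (n := n) (f := f) u.time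
    have hstep := hf u v (by omega)
    have hE := codeFrontier_succ_of_eq hv hA (by simp)
    rw [hAB'] at hnd
    rw [← (show u.time = v.time + 1 by omega), hAB'] at hE
    intro y hy hyA
    have hy' := (notMem_of_nodup_append hnd (List.mem_map_of_mem hy)).1
    by_cases hle : A.length ≤ A'.length
    · have hpre := prefix_of_append_eq hE.symm hle
      exact hy' (hpre.subset hyA)
    -- Otherwise `hstep` forces `u` to be a product with its left input last in `A` and its right
    -- input the first output of `v`, which is not yet open at the time of `v`.
    · rcases u with c | p
      · simp only [Op.inputs, List.length_cons, List.length_nil] at hstep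
        omega
      · simp only [Op.inputs, List.length_cons, List.length_nil, List.map_cons,
          List.map_nil] at hstep hE
        have hE' : (A' ++ [g (.prodLeft p)]) ++ (g (.prodRight p) :: B') =
            A ++ (v.outputs ++ B) := by simpa using hE
        have h2 := (List.append_inj hE' (by simp; omega)).2
        obtain ⟨x, l, hx⟩ : ∃ x l, v.outputs = x :: l := by cases v <;> simp [Op.outputs]
        rw [hx, List.cons_append, List.cons.injEq] at h2
        have h3 := birth_le_of_mem_codeFrontier (hu (.prodRight p) (by simp [Op.inputs]))
        have h4 : x.birth = v.time + 1 := OutPort.birth_eq.2 (by simp [hx])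
        rw [h2.1] at h3
        omega
  | succ d ih =>
    obtain ⟨v', hv'⟩ := exists_time_eq (n := n) (k := v.time + 1) (by have := u.time_lt; omega)
    obtain ⟨A', B', hAB', hA'⟩ := h v'
    have hstep := hf v' v hv'
    have hE := codeFrontier_succ_of_eq hv hA (by simp)
    rw [← hv', hAB'] at hE
    have hu' : ∀ y ∈ u.inputs, g y ∈ codeFrontier n f v'.time := fun y hy =>
      mem_codeFrontier_of_le (h.mem hy)
        ((birth_le_of_mem_codeFrontier (hu y hy)).trans (by omega)) (by omega)
    have hy' := ih (by omega) hAB' hA' hu' (by omega)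
    intro y hy hyA
    by_cases hle : A.length ≤ A'.length
    · have hpre := prefix_of_append_eq hE.symm hle
      exact hy' y hy (hpre.subset hyA)
    -- Otherwise `A` exceeds `A'` by one wire, the left input of the product `v'`; that wire is used
    -- up before `u`.
    · rcases v' with c | p
      · simp only [Op.inputs, List.length_cons, List.length_nil] at hstep
        omega
      · simp only [Op.inputs, List.length_cons, List.length_nil, List.map_cons,
          List.map_nil] at hstep hE
        have hE' : (A' ++ [g (.prodLeft p)]) ++ (g (.prodRight p) :: B') =
            A ++ (v.outputs ++ B) := by simpa using hE
        have h2 := (List.append_inj hE' (by simp; omega)).1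
        rw [← h2, List.mem_append, List.mem_singleton] at hyA
        rcases hyA with hyA | hyA
        · exact hy' y hy hyA
        · refine h.notMem (v := .prod p) (y := .prodLeft p) (m := u.time) (by simp [Op.inputs])
            (by omega) ?_
          rw [← hyA]
          exact h.mem hy

/-- Later operators are excluded by `Splits.notMem_left`; earlier ones are not ready, because their
input wires are no longer open. -/
theorem Named.leftmostReady_codeFrontier {G : Named n} (hf : IsCode n f)
    (h : Splits G.wire.symm f) (v : Op n) :
    G.leftmostReady (codeFrontier n f v.time) = some v := by
  obtain ⟨A, B, hAB, hA⟩ := h v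
  refine leftmostReady_eq_some hAB fun u hu y hy => ?_
  rcases lt_trichotomy v.time u.time with hlt | heq | hlt
  · exact h.notMem_left hf.step hlt hAB hA hu y hy
  · obtain rfl := Op.time_injective heq
    have hnd := nodup_codeFrontier (n := n) (f := f) v.time
    rw [hAB] at hnd
    exact (notMem_of_nodup_append hnd (List.mem_map_of_mem hy)).1
  · exact absurd (hu y hy) (h.notMem hy hlt)

theorem Named.labelling_of_code {G : Named n} (hf : IsCode n f) (h : Splits G.wire.symm f) :
    G.labelling = canonicalOrder n := by
  have key : ∀ m k, k + m = 2 * n →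
      G.labelFrom m (codeFrontier n f k) = (canonicalOrder n).drop k := by
    intro m
    induction m with
    | zero =>
      intro k hk
      rw [List.drop_eq_nil_of_le (by rw [length_canonicalOrder]; omega)]
      rfl
    | succ m ih =>
      intro k hk
      obtain ⟨v, rfl⟩ := exists_time_eq (n := n) (k := k) (by omega)
      obtain ⟨A, B, hAB, hA⟩ := h v
      rw [labelFrom, leftmostReady_codeFrontier hf h v, drop_canonicalOrder_time]
      dsimp only
      rw [advance_eq (nodup_codeFrontier _) hAB, ← codeFrontier_succ_of_eq hAB hA (by simp),
        ih _ (by omega)]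
  exact key (2 * n) 0 (by omega)

/-! ### The code of a prograph -/

namespace Named

variable (G : Named n)

/-- The open wires after `k` steps of the canonical order. -/
def frontier : ℕ → List (OutPort n)
  | 0 => [.source]
  | k + 1 =>
    match opAt n k with
    | some v => G.advance (frontier k) v
    | none => frontier k

/-- The position in which the operator of time `k` is plugged. -/
def code (k : ℕ) : ℕ :=
  match opAt n k with
  | some v => (G.frontier k).idxOf (G.wire.symm (v.inputs.headD .sink))
  | none => 0

variable {G}

theorem labelFrom_succ_eq_cons {m : ℕ} {F : List (OutPort n)} {v : Op n} {l : List (Op n)}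
    (h : G.labelFrom (m + 1) F = v :: l) :
    G.leftmostReady F = some v ∧ G.labelFrom m (G.advance F v) = l := by
  rw [labelFrom] at h
  split at h
  · simp at h
  · rename_i u hu
    rw [List.cons.injEq] at h
    obtain ⟨rfl, h⟩ := h
    exact ⟨hu, h⟩

theorem frontier_succ (v : Op n) :
    G.frontier (v.time + 1) = G.advance (G.frontier v.time) v := by
  simp [frontier]

theorem leftmostReady_frontier (hG : G.labelling = canonicalOrder n) (v : Op n) :
    G.leftmostReady (G.frontier v.time) = some v := by
  have step : ∀ v : Op n,
      G.labelFrom (2 * n - v.time) (G.frontier v.time) = (canonicalOrder n).drop v.time →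
      G.leftmostReady (G.frontier v.time) = some v ∧
        G.labelFrom (2 * n - (v.time + 1)) (G.frontier (v.time + 1)) =
          (canonicalOrder n).drop (v.time + 1) := by
    intro v h
    have := v.time_lt
    rw [drop_canonicalOrder_time, show 2 * n - v.time = 2 * n - (v.time + 1) + 1 by omega] at h
    rw [frontier_succ]
    exact labelFrom_succ_eq_cons h
  have key : ∀ k ≤ 2 * n,
      G.labelFrom (2 * n - k) (G.frontier k) = (canonicalOrder n).drop k := by
    intro k
    induction k with
    | zero => exact fun _ => hG
    | succ k ih =>
      intro hk
      obtain ⟨v, rfl⟩ := exists_time_eq hk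
      exact (step v (ih (by omega))).2
  exact (step v (key _ v.time_lt.le)).1

end Named

/-! ### Distinct regions along the open wires -/

section Regions

variable {α : Type*} {L R : OutPort n → α} {w : OutPort n ≃ InPort n} {name : FaceName n → α}

/-- The two inputs of a product share a region; as the regions along `F` are distinct, the two wires
are neighbours. -/
theorem ClosedColoring.exists_append (C : ClosedColoring w name L R) {a b : α}
    {F : List (OutPort n)} (h : Linked L R a F b) (hnd : (a :: F.map R).Nodup) {v : Op n}
    (hv : ∀ y ∈ v.inputs, w.symm y ∈ F) : ∃ A B, F = A ++ v.inputs.map w.symm ++ B := by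
  cases v with
  | cop c =>
    obtain ⟨A, B, rfl⟩ := List.append_of_mem (hv (.copIn c) (by simp [Op.inputs]))
    exact ⟨A, B, by simp [Op.inputs]⟩
  | prod p =>
    exact h.exists_append hnd (hv (.prodLeft p) (by simp [Op.inputs]))
      (hv (.prodRight p) (by simp [Op.inputs])) (C.between p)

/-- The regions along the open wires `F` are distinct; those between two wires are named after
one of the first `k` coproducts. -/
structure DistinctRegions (name : FaceName n → α) (L R : OutPort n → α) (k : ℕ)
    (F : List (OutPort n)) : Prop where
  linked : Linked L R (name (.inr false)) F (name (.inr true))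
  nodup : (name (.inr false) :: F.map R).Nodup
  lt : ∀ x ∈ F, ∃ l, R x = name l ∧ ∀ c : Fin n, l = .inl c → (c : ℕ) < k

theorem DistinctRegions.source (C : RegionColoring w name L R) (hname : Function.Injective name) :
    DistinctRegions name L R 0 [.source] where
  linked := ⟨C.left_source, C.right_source⟩
  nodup := by simp [C.right_source, hname.eq_iff]
  lt x hx := by
    obtain rfl := List.mem_singleton.1 hx
    exact ⟨_, C.right_source, by simp⟩

/-- A coproduct inserts the region named after itself, which is new because all earlier names belong
to smaller coproducts or are outer. A product only removes a region. -/
theorem DistinctRegions.succ (C : RegionColoring w name L R) (hname : Function.Injective name)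
    {v : Op n} {A B : List (OutPort n)}
    (h : DistinctRegions name L R v.time (A ++ v.inputs.map w.symm ++ B)) :
    DistinctRegions name L R (v.time + 1) (A ++ v.outputs ++ B) := by
  have hAB : ∀ x, x ∈ A ∨ x ∈ B ∨ (∃ y ∈ v.inputs, w.symm y = x) →
      ∃ l, R x = name l ∧ ∀ c : Fin n, l = .inl c → (c : ℕ) < v.time + 1 := by
    intro x hx
    obtain ⟨l, h1, h3⟩ := h.lt x (by
      simp only [List.mem_append, List.mem_map]
      rcases hx with hx | hx | hx
      · exact .inl (.inl hx)
      · exact .inr hx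
      · exact .inl (.inr hx))
    exact ⟨l, h1, fun c hc => (h3 c hc).trans (by omega)⟩
  refine ⟨C.linked_succ h.linked, ?_, ?_⟩
  · have hnd := h.nodup
    cases v with
    | cop c =>
      have hnew : name (.inl c) ∉ (name (.inr false) ::
          (A ++ (Op.cop c).inputs.map w.symm ++ B).map R) := by
        intro hmem
        rcases List.mem_cons.1 hmem with hmem | hmem
        · simpa using hname hmem
        · obtain ⟨x, hx, hxc⟩ := List.mem_map.1 hmem
          obtain ⟨l, h1, h3⟩ := h.lt x hx
          exact lt_irrefl _ (h3 c (hname (h1.symm.trans hxc)))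
      have e : name (.inr false) :: (A ++ (Op.cop c).outputs ++ B).map R =
          (name (.inr false) :: A.map R) ++
            name (.inl c) :: ((Op.cop c).inputs.map w.symm ++ B).map R := by
        simp [Op.inputs, Op.outputs, C.right_copLeft, C.right_copRight]
      rw [e, List.nodup_middle, List.nodup_cons]
      simp only [List.map_append, List.cons_append, List.append_assoc] at hnew hnd ⊢
      exact ⟨hnew, hnd⟩
    | prod p =>
      refine hnd.sublist (List.Sublist.cons_cons _ ?_)
      simp only [Op.inputs, Op.outputs, List.map_append, List.map_cons, List.map_nil,
        C.right_prodOut]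
      exact ((List.Sublist.refl _).append (List.sublist_cons_self _ _)).append
        (List.Sublist.refl _)
  · intro x hx
    rw [List.mem_append, List.mem_append] at hx
    rcases hx with (hx | hx) | hx
    · exact hAB x (.inl hx)
    · cases v with
      | cop c =>
        simp only [Op.outputs, List.mem_cons, List.not_mem_nil, or_false] at hx
        rcases hx with rfl | rfl
        · exact ⟨_, C.right_copLeft c, by simp [Op.time]⟩
        · rw [C.right_copRight]
          exact hAB _ (.inr (.inr ⟨_, by simp [Op.inputs], rfl⟩))
      | prod p =>
        simp only [Op.outputs, List.mem_cons, List.not_mem_nil, or_false] at hx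
        subst hx
        rw [C.right_prodOut]
        exact hAB _ (.inr (.inr ⟨_, by simp [Op.inputs], rfl⟩))
    · exact hAB x (.inr (.inl hx))

end Regions

namespace Named

variable {G : Named n}

theorem code_eq {v : Op n} {A B : List (OutPort n)} (hF : (G.frontier v.time).Nodup)
    (h : G.frontier v.time = A ++ v.inputs.map G.wire.symm ++ B) : A.length = G.code v.time := by
  obtain ⟨y, l, hy⟩ := v.inputs_ne_nil
  rw [code, opAt_time]
  dsimp only
  rw [hy, List.map_cons, List.append_assoc, List.cons_append] at h
  rw [hy, List.headD_cons, idxOf_of_eq_append hF h]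

/-- Both claims need a common induction: distinct regions make the next inputs consecutive, so
`advance` is the step prescribed by the code, and this step keeps the regions distinct. -/
theorem frontier_eq_codeFrontier (hG : G.labelling = canonicalOrder n) {k : ℕ}
    (hk : k ≤ 2 * n) : G.frontier k = codeFrontier n G.code k ∧
      DistinctRegions (nameFace G.wire) (fun x => faceOf G.wire (.inr (G.wire x)))
        (fun x => faceOf G.wire (.inl x)) k (G.frontier k) := by
  have C := closedColoring_faceOf G.wire
  have hname := nameFace_injective G.acyclic G.planar
  induction k with
  | zero => exact ⟨rfl, .source C.toRegionColoring hname⟩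
  | succ k ih =>
    obtain ⟨v, rfl⟩ := exists_time_eq hk
    obtain ⟨ih, hD⟩ := ih (by omega)
    have hnd : (G.frontier v.time).Nodup := ih ▸ nodup_codeFrontier _
    obtain ⟨A, B, hAB⟩ := C.exists_append hD.linked hD.nodup
      (ready_of_leftmostReady (leftmostReady_frontier hG v))
    have hsucc : G.frontier (v.time + 1) = A ++ v.outputs ++ B := by
      rw [frontier_succ, advance_eq hnd hAB]
    refine ⟨?_, ?_⟩
    · rw [hsucc, codeFrontier_succ_of_eq (ih.symm.trans hAB) (code_eq hnd hAB) (by simp)]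
    · rw [hsucc]
      rw [hAB] at hD
      exact hD.succ C.toRegionColoring hname

theorem splits_code (hG : G.labelling = canonicalOrder n) : Splits G.wire.symm G.code := by
  intro v
  obtain ⟨h, hD⟩ := frontier_eq_codeFrontier hG v.time_lt.le
  obtain ⟨A, B, hAB⟩ := (closedColoring_faceOf G.wire).exists_append hD.linked hD.nodup
    (ready_of_leftmostReady (leftmostReady_frontier hG v))
  exact ⟨A, B, h ▸ hAB, code_eq (h ▸ nodup_codeFrontier _) hAB⟩

theorem fits_code (hG : G.labelling = canonicalOrder n) (v : Op n) :
    G.code v.time + v.inputs.length ≤ (codeFrontier n G.code v.time).length := by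
  obtain ⟨A, B, hAB, hA⟩ := splits_code hG v
  simp [hAB, ← hA]

theorem realizes_code (hG : G.labelling = canonicalOrder n) :
    Realizes G.wire.symm G.code := by
  refine ⟨splits_code hG, ?_⟩
  have h1 := length_codeFrontier (fun v => .inr (fits_code hG v)) (le_refl (2 * n))
  have h2 : frontierLength n (2 * n) = 1 := by
    unfold frontierLength
    split_ifs <;> omega
  rw [h2, List.length_eq_one_iff] at h1
  obtain ⟨x, hx⟩ := h1
  rw [hx]
  congr 1
  -- The remaining wire ends at the global output, since every input wire of an operator has been
  -- used up.
  rw [Equiv.eq_symm_apply]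
  rcases h : (G.wire x).owner with _ | u
  · cases hy : G.wire x <;> simp_all [InPort.owner]
  · refine absurd ?_ ((splits_code hG).notMem (InPort.owner_eq_some.1 h) u.time_lt)
    simp [hx]

theorem isCode_code (hG : G.labelling = canonicalOrder n) : IsCode n G.code where
  zero k hk := by rw [code, opAt_eq_none.2 hk]
  fits v := by
    rw [← length_codeFrontier (fun v => .inr (fits_code hG v)) v.time_lt.le]
    exact fits_code hG v
  step u v huv := by
    by_contra hlt
    obtain ⟨A, B, hAB, hA⟩ := splits_code hG v
    obtain ⟨A', B', hAB', hA'⟩ := splits_code hG u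
    rw [huv, codeFrontier_succ_of_eq hAB hA (by simp)] at hAB'
    -- If the condition failed, all inputs of `u` would be open to the left of those of `v`, and `v`
    -- would not have been the leftmost ready operator.
    have hpre : A' ++ u.inputs.map G.wire.symm <+: A := by
      refine prefix_of_append_eq (X := []) (by simpa using hAB'.symm) ?_
      simp only [List.length_append, List.length_map]
      omega
    have h := leftmostReady_frontier hG v
    rw [(frontier_eq_codeFrontier hG v.time_lt.le).1] at h
    exact not_subset_of_leftmostReady (nodup_codeFrontier _) hAB h u fun y hy =>
      hpre.subset (List.mem_append_right _ (List.mem_map_of_mem hy))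

end Named

theorem card_canonical (n : ℕ) :
    Nat.card {G : Named n // G.labelling = canonicalOrder n} = Nat.card {f // IsCode n f} := by
  refine Nat.card_eq_of_bijective (fun G => ⟨G.1.code, Named.isCode_code G.2⟩) ⟨?_, ?_⟩
  · rintro ⟨G, hG⟩ ⟨H, hH⟩ h
    have h1 : G.code = H.code := congrArg Subtype.val h
    have h2 : Realizes H.wire.symm G.code := h1 ▸ Named.realizes_code hH
    have h3 := (Named.realizes_code hG).unique h2
    exact Subtype.ext (Named.ext (Equiv.symm_bijective.injective (DFunLike.coe_injective h3)))
  · rintro ⟨f, hf⟩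
    obtain ⟨w, hw⟩ := hf.exists_realizes
    have hG : hw.toNamed.labelling = canonicalOrder n := Named.labelling_of_code hf hw.splits
    refine ⟨⟨hw.toNamed, hG⟩, Subtype.ext (funext fun k => ?_)⟩
    by_cases hk : k < 2 * n
    · exact (Named.splits_code hG).code_unique hw.splits hk
    · exact ((Named.isCode_code hG).zero k (by omega)).trans (hf.zero k (by omega)).symm

/-! ### Codes as pairs of ballot sequences -/

/-- The product at time `2 * n - 1 - k` meets `k + 2` open wires and uses two of them, so counting
from the top gives both halves the bound `k`. -/
theorem isCode_iff {f : ℕ → ℕ} : IsCode n f ↔ (∀ k, 2 * n ≤ k → f k = 0) ∧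
    (∀ k < n, f k ≤ k) ∧ (∀ k < n, f (2 * n - 1 - k) ≤ k) ∧ (∀ k, k + 1 < n → f k ≤ f (k + 1)) ∧
    (∀ k, k + 1 < n → f (2 * n - 1 - (k + 1)) ≤ f (2 * n - 1 - k) + 1) ∧
    (0 < n → f (n - 1) ≤ f n + 1) := by
  constructor
  · intro h
    refine ⟨h.zero, fun k hk => ?_, fun k hk => ?_, fun k hk => ?_, fun k hk => ?_, fun hn => ?_⟩
    · have := h.fits (.cop ⟨k, hk⟩)
      rw [frontierLength_cop] at this
      simpa [Op.inputs, Op.time] using this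
    · have := h.fits (.prod ⟨n - 1 - k, by omega⟩)
      rw [frontierLength_prod] at this
      simp only [Op.inputs, Op.time, List.length_cons, List.length_nil] at this
      rw [show n + (n - 1 - k) = 2 * n - 1 - k by omega] at this
      omega
    · have := h.step (.cop ⟨k + 1, hk⟩) (.cop ⟨k, by omega⟩) rfl
      simp only [Op.inputs, Op.time, List.length_cons, List.length_nil] at this
      omega
    · have := h.step (.prod ⟨n - 1 - k, by omega⟩) (.prod ⟨n - 1 - (k + 1), by omega⟩)
        (by simp only [Op.time]; omega)
      simp only [Op.inputs, Op.time, List.length_cons, List.length_nil] at this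
      rw [show n + (n - 1 - k) = 2 * n - 1 - k by omega,
        show n + (n - 1 - (k + 1)) = 2 * n - 1 - (k + 1) by omega] at this
      omega
    · have := h.step (.prod ⟨0, hn⟩) (.cop ⟨n - 1, by omega⟩) (by simp only [Op.time]; omega)
      simp only [Op.inputs, Op.time, List.length_cons, List.length_nil, Nat.add_zero] at this
      omega
  · rintro ⟨h0, h1, h2, h3, h4, h5⟩
    refine ⟨h0, fun v => ?_, fun u v huv => ?_⟩
    · rcases v with c | p
      · rw [frontierLength_cop]
        exact Nat.add_le_add_right (h1 c c.isLt) 1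
      · have := h2 (n - 1 - p) (by omega)
        rw [show 2 * n - 1 - (n - 1 - (p : ℕ)) = n + p by omega] at this
        rw [frontierLength_prod]
        simp only [Op.inputs, Op.time, List.length_cons, List.length_nil]
        omega
    · rcases u with c | p <;> rcases v with d | q <;>
        simp only [Op.inputs, Op.time, List.length_cons, List.length_nil] at huv ⊢
      · have := h3 d (by omega)
        rw [huv]
        omega
      · omega
      · have := h5 (by omega)
        rw [show n + (p : ℕ) = n by omega, show (d : ℕ) = n - 1 by omega]
        omega
      · have := h4 (n - 1 - p) (by omega)
        rw [show 2 * n - 1 - (n - 1 - (p : ℕ) + 1) = n + q by omega,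
          show 2 * n - 1 - (n - 1 - (p : ℕ)) = n + p by omega] at this
        omega

/-- Codes are pairs of ballot sequences: the products are read from top to bottom and from right
to left. -/
def codeEquiv (n : ℕ) : {f // IsCode n f} ≃
    {p : (ℕ → ℕ) × (ℕ → ℕ) // (p.1 ∈ ballotSeqs n ∧ p.2 ∈ ballotSeqs n) ∧
      p.1 (n - 1) + p.2 (n - 1) ≤ n} where
  toFun f := ⟨(fun k => if k < n then f.1 k else 0,
      -- Of the `k + 2` open wires, `k - f` lie to the right of the two inputs. The bound `+ 1`
      -- between successive products becomes weak monotonicity, and the one at the transition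
      -- becomes the bound on the sum of the final entries.
      fun k => if k < n then k - f.1 (2 * n - 1 - k) else 0), by
    obtain ⟨f, hf⟩ := f
    obtain ⟨h0, h1, h2, h3, h4, h5⟩ := isCode_iff.1 hf
    simp only [mem_ballotSeqs]
    refine ⟨⟨⟨fun k hk => if_neg (by omega), fun k hk => ?_, fun k hk => ?_⟩,
      ⟨fun k hk => if_neg (by omega), fun k hk => ?_, fun k hk => ?_⟩⟩, ?_⟩
    · rw [if_pos hk]
      exact h1 k hk
    · rw [if_pos (by omega), if_pos hk]
      exact h3 k hk
    · rw [if_pos hk]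
      omega
    · have := h4 k hk
      rw [if_pos (by omega), if_pos hk]
      have := h2 (k + 1) hk
      have := h2 k (by omega)
      omega
    · rcases Nat.eq_zero_or_pos n with rfl | hn
      · simp
      · have h := h5 hn
        have h' := h2 (n - 1) (by omega)
        rw [show 2 * n - 1 - (n - 1) = n by omega] at h'
        rw [if_pos (by omega), if_pos (by omega), show 2 * n - 1 - (n - 1) = n by omega]
        omega⟩
  invFun p := ⟨fun k => if k < n then p.1.1 k else
      if k < 2 * n then 2 * n - 1 - k - p.1.2 (2 * n - 1 - k) else 0, by
    obtain ⟨⟨p, q⟩, ⟨hp, hq⟩, hpq⟩ := p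
    rw [mem_ballotSeqs] at hp hq
    obtain ⟨-, hp1, hp2⟩ := hp
    obtain ⟨-, hq1, hq2⟩ := hq
    simp only at hpq hp1 hp2 hq1 hq2
    rw [isCode_iff]
    refine ⟨fun k hk => ?_, fun k hk => ?_, fun k hk => ?_, fun k hk => ?_, fun k hk => ?_,
      fun hn => ?_⟩
    · rw [if_neg (by omega), if_neg (by omega)]
    · rw [if_pos hk]
      exact hp1 k hk
    · rw [if_neg (by omega), if_pos (by omega)]
      omega
    · rw [if_pos (by omega), if_pos hk]
      exact hp2 k hk
    · rw [if_neg (by omega), if_pos (by omega), if_neg (by omega), if_pos (by omega),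
        show 2 * n - 1 - (2 * n - 1 - k) = k by omega,
        show 2 * n - 1 - (2 * n - 1 - (k + 1)) = k + 1 by omega]
      have := hq2 k hk
      dsimp only
      omega
    · rw [if_pos (by omega), if_neg (by omega), if_pos (by omega),
        show 2 * n - 1 - n = n - 1 by omega]
      dsimp only
      omega⟩
  left_inv f := by
    obtain ⟨f, hf⟩ := f
    obtain ⟨h0, h1, h2, -⟩ := isCode_iff.1 hf
    refine Subtype.ext (funext fun k => ?_)
    dsimp only
    split_ifs with h h' h''
    · rfl
    · have := h2 (2 * n - 1 - k) h''
      rw [show 2 * n - 1 - (2 * n - 1 - k) = k by omega] at this ⊢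
      omega
    · omega
    · exact (h0 k (by omega)).symm
  right_inv p := by
    obtain ⟨⟨p, q⟩, ⟨hp, hq⟩, hpq⟩ := p
    rw [mem_ballotSeqs] at hp hq
    refine Subtype.ext (Prod.ext (funext fun k => ?_) (funext fun k => ?_))
    · dsimp only
      split_ifs with h
      · rfl
      · exact (hp.1 k (by omega)).symm
    · dsimp only
      split_ifs with h h' h''
      · omega
      · have := hq.2.1 k h
        simp only at this
        rw [show 2 * n - 1 - (2 * n - 1 - k) = k by omega]
        omega
      · omega
      · exact (hq.1 k (by omega)).symm

theorem card_coproductsFirst_eq_sum (n : ℕ) :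
    (Nat.card {P : PCPrograph n // P.CoproductsFirst} : ℤ) =
      ∑ d ∈ Finset.range (n + 1) ×ˢ Finset.range (n + 1) with d.1 + d.2 ≤ n,
        catTriangle n d.1 * catTriangle n d.2 := by
  rw [card_coproductsFirst, card_canonical, Nat.card_congr (codeEquiv n), card_ballotPairs]

end PCPrograph

theorem mainTheorem4 (n : ℕ) :
    -- The prographs in question are counted by pairs of binary trees.
    Nat.card {P : PCPrograph n // P.CoproductsFirst} =
      Nat.card {T : BinaryTree Unit × BinaryTree Unit //
        T.1.numNodes = n ∧ T.2.numNodes = n ∧ disabledSites T.1 + disabledSites T.2 ≤ n} ∧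
    -- Their number as a sum over the Catalan triangle, and in closed form.
    (Nat.card {P : PCPrograph n // P.CoproductsFirst} : ℤ) =
      ∑ d ∈ Finset.range (n + 1) ×ˢ Finset.range (n + 1) with d.1 + d.2 ≤ n,
        catTriangle n d.1 * catTriangle n d.2 ∧
    ∑ d ∈ Finset.range (n + 1) ×ˢ Finset.range (n + 1) with d.1 + d.2 ≤ n,
        catTriangle n d.1 * catTriangle n d.2 =
      binom (3 * n) n - 2 * binom (3 * n) ((n : ℤ) - 1) + binom (3 * n) ((n : ℤ) - 2) ∧
    -- The numbers in the sum are those of the Catalan triangle (here `n ≥ 1`).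
    ∀ k < n, catTriangle n k =
      binom (n - 1 + k) k - binom (n - 1 + k) ((k : ℤ) - 1) := by
  refine ⟨?_, PCPrograph.card_coproductsFirst_eq_sum n, sum_catTriangle_mul n, fun k hk =>
    catTriangle_eq_binom hk⟩
  rw [← Nat.cast_inj (R := ℤ), PCPrograph.card_coproductsFirst_eq_sum, card_treePairs]
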